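/- Let $d\in\mathbb N=\{1,2,\dots\}$, $-\infty<a<b<\infty$, $K,L\in(0,\infty)$, $\varrho\in(0,1]$, $p\in[2,\infty)$. Let $\|x\|=\sum_{k=1}^d|x_k|$ on $\mathbb R^d$, let $B(x,r)$ be the closed ball, and put $$\bar R=\max\Bigl\{K(1+b-a)\bigl(1+e^{K(b-a)}(1+K(b-a))\bigr),\ K+(b-a)(1+K)+\bigl(\tfrac1K+1\bigr)(1+K(b-a))\bigl(e^{K(b-a)(1+K(b-a))}(1+K)-1\bigr)\Bigr\}.$$ Let $F^{\varrho}$ be the class of pairs $(\eta,f)$, $\eta\in\mathbb R^d$, $f:[a,b]\times\mathbb R^d\to\mathbb R^d$, such that $\|\eta\|\le K$; $f$ is continuous; $\|f(t,x)\|\le K(1+\|x\|)$ for all $t,x$; $\|f(t,x)-f(s,x)\|\le L|t-s|^{\varrho}$ for $t,s\in[a,b]$, $x\in B(\eta,\bar R)$; and $\|f(t,x)-f(t,y)\|\le L\|x-y\|$ for $t\in[a,b]$, $x,y\in B(\eta,\bar R)$. For $(\eta,f)\in F^\varrho$ let $z(\eta,f)$ be the unique solution of $z'(t)=f(t,z(t))$,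 $t\in[a,b]$, $z(a)=\eta$. For $\delta\in[0,1]$ let $V_{(\eta,f)}(\delta)$ be the set of pairs $(\tilde\eta,\tilde f)$ with $\tilde\eta\in B(\eta,\delta)$ and $\tilde f=f+\tilde\delta_f$, where $\tilde\delta_f:[a,b]\times\mathbb R^d\to\mathbb R^d$ is Borel measurable and $\|\tilde\delta_f\|\le\delta$ everywhere. Let $(\Omega,\Sigma,\mathbb P)$ be a probability space. A randomized algorithm $\mathcal A$ with $i$ steps, using $2i$ noisy evaluations, is given by points $t_0,\dots,t_{i-1}\in[a,b]$, a random vector $\theta=(\theta_0,\dots,\theta_{i-1}):\Omega\to[a,b]^i$ and Borel maps $\psi_j,\chi_j,\varphi$ as follows. On the data $(\tilde\eta,\tilde f)$ it computes, for $j=0,\dots,i-1$, $$u_j=\tilde f(t_j,y_j),\quad y_j=\psi_j(\theta,\tilde\eta,u_0,\dots,u_{j-1},w_0,\dots,w_{j-1}),$$ $$w_j=\tilde f(\theta_j,z_j),\quad z_j=\chi_j(\theta,\tilde\eta,u_0,\dots,u_{j},w_0,\dots,w_{j-1}),$$ and its output is $\mathcal A(\tilde\eta,\tilde f)=\varphi(\theta,\tilde\eta,u_0,\dots,u_{i-1},w_0,\dots,w_{i-1})\in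 D([a,b];\mathbb R^d)$, the space of right-continuous functions with left limits, with the $\sigma$-field generated by the coordinate mappings. Let $\Phi_n$ be the class of such algorithms with $2i\le n$, and let $$e^{(p)}(\mathcal A,F^\varrho,\delta)=\sup_{(\eta,f)\in F^\varrho}\ \sup_{(\tilde\eta,\tilde f)\in V_{(\eta,f)}(\delta)}\Bigl(\mathbb E\sup_{a\le t\le b}\|z(\eta,f)(t)-\mathcal A(\tilde\eta,\tilde f)(t)\|^p\Bigr)^{1/p},\qquad e_n^{(p)}(F^\varrho,\delta)=\inf_{\mathcal A\in\Phi_n}e^{(p)}(\mathcal A,F^\varrho,\delta).$$ Given independent random variables $\tau_1,\tau_2,\dots$ on $\Omega$, uniformly distributed on $[0,1]$ and with values in $[0,1]$, the randomized two-stage Runge–Kutta method with $m\ge1$ steps is, with $h=(b-a)/m$, $t_j=a+jh$, $$\bar V^0=\tilde\eta,\quad \bar V^j_\tau=\bar V^{j-1}+h\tau_j\tilde f(t_{j-1},\bar V^{j-1}),\quad \bar V^j=\bar V^{j-1}+h\tilde f(t_{j-1}+\tau_jh,\bar V^j_\tau),\quad 1\le j\le m;$$ its output $\bar l_m$ is the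 piecewise linear interpolation of $\bar V^0,\dots,\bar V^m$ at $t_0,\dots,t_m$. **Theorem.** There are constants $c,C>0$, $\delta_0\in(0,1]$ and $n_0\in\mathbb N$, depending only on $a,b,d,\varrho,K,L,p$, such that for all $n\ge n_0$ and $\delta\in[0,\delta_0]$: 1. on every probability space, $e_n^{(p)}(F^\varrho,\delta)\ \ge\ c\max\{n^{-(\varrho+1/2)},\delta\}$; 2. on every probability space that carries a sequence $(\tau_j)$ as above, $\bar l_{\lfloor n/2\rfloor}\in\Phi_n$ and $$e_n^{(p)}(F^\varrho,\delta)\le e^{(p)}(\bar l_{\lfloor n/2\rfloor},F^\varrho,\delta)\le C\max\{n^{-(\varrho+1/2)},\delta\}.$$ That is, $e^{(p)}_n(F^{\varrho},\delta)=\Theta(\max\{n^{-(\varrho+1/2)},\delta\})$ as $n\to\infty$ and $\delta\to0+$, and the randomized Runge–Kutta method attains this order, i.e. it is optimal. -/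

import Mathlib

open MeasureTheory ProbabilityTheory Set Filter Topology
open scoped ENNReal

noncomputable section

namespace NoisyODE

/-- `ℝ^d` with the norm `‖x‖ = ∑ k, |x k|`. -/
abbrev E (d : ℕ) : Type := PiLp 1 (fun _ : Fin d => ℝ)

/-- A right-hand side `[a,b] × ℝ^d → ℝ^d`. -/
abbrev RHS (a b : ℝ) (d : ℕ) : Type := Icc a b × E d → E d

/-- The localization radius of the problem class. -/
def Rbar (a b K : ℝ) : ℝ :=
  max (K * (1 + b - a) * (1 + Real.exp (K * (b - a)) * (1 + K * (b - a))))
    (K + (b - a) * (1 + K) +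
      (1 / K + 1) * (1 + K * (b - a)) *
        (Real.exp (K * (b - a) * (1 + K * (b - a))) * (1 + K) - 1))

/-- The class `F^ϱ(K, L)` of pairs `(η, f)`. -/
structure InClass (a b : ℝ) (d : ℕ) (K L ϱ : ℝ) (η : E d) (f : RHS a b d) : Prop where
  norm_init : ‖η‖ ≤ K
  cont : Continuous f
  growth : ∀ t x, ‖f (t, x)‖ ≤ K * (1 + ‖x‖)
  holder : ∀ t s : Icc a b, ∀ x ∈ Metric.closedBall η (Rbar a b K),
    ‖f (t, x) - f (s, x)‖ ≤ L * |(t : ℝ) - s| ^ ϱ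
  lipschitz : ∀ t : Icc a b, ∀ x ∈ Metric.closedBall η (Rbar a b K),
    ∀ y ∈ Metric.closedBall η (Rbar a b K), ‖f (t, x) - f (t, y)‖ ≤ L * ‖x - y‖

/-- `z` solves `z'(t) = f(t, z(t))` on `[a,b]` (one-sided derivatives at the end points),
`z(a) = η`. -/
def IsSolution {a b : ℝ} {d : ℕ} (η : E d) (f : RHS a b d) (z : ℝ → E d) : Prop :=
  z a = η ∧ ∀ t : Icc a b, HasDerivWithinAt z (f (t, z t)) (Icc a b) t

/-- The solution `z(η, f)`. For `(η, f)` in the class `InClass` a solution exists and its values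
on `[a,b]` are unique; only these values are used. -/
def sol {a b : ℝ} {d : ℕ} (η : E d) (f : RHS a b d) : ℝ → E d :=
  Classical.epsilon (IsSolution η f)

/-- The set `V_{(η,f)}(δ)` of noisy versions `(η', f')` of `(η, f)`: `η'` lies in the closed ball
`B(η, δ)` and `f' = f + e` with `e` Borel measurable and bounded by `δ` everywhere. -/
def IsNoisy {a b : ℝ} {d : ℕ} (δ : ℝ) (η : E d) (f : RHS a b d)
    (η' : E d) (f' : RHS a b d) : Prop :=
  η' ∈ Metric.closedBall η δ ∧
    ∃ e : RHS a b d, Measurable e ∧ (∀ q, ‖e q‖ ≤ δ) ∧ f' = f + e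

/-- Right-continuous functions with left limits, i.e. elements of `D([a,b]; ℝ^d)`. -/
def IsCadlag {a b : ℝ} {d : ℕ} (g : Icc a b → E d) : Prop :=
  ∀ t, ContinuousWithinAt g (Ici t) t ∧ ∃ l, Tendsto g (𝓝[<] t) (𝓝 l)

/-- A randomized algorithm with `i` steps. In step `j` it evaluates the (noisy) right-hand side at
`(t j, y_j)` and then at `(θ j, z_j)`, where `t j` is deterministic, `(θ 0, …, θ (i-1))` is a random
vector, and `y_j`, `z_j` are Borel functions of the random vector, the (noisy) initial value and
the values obtained so far. The output is a Borel function of all these data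
with values in `D([a,b]; ℝ^d)`, whose Borel `σ`-field is generated by the coordinate mappings. -/
structure Algorithm (a b : ℝ) (d : ℕ) (Ω : Type*) [MeasurableSpace Ω] where
  /-- the number of steps -/
  i : ℕ
  /-- the deterministic evaluation times -/
  t : Fin i → Icc a b
  /-- the random evaluation times -/
  θ : Fin i → Ω → Icc a b
  measurable_θ : ∀ j, Measurable (θ j)
  /-- `y_j = ψ j (θ, η', values at (t k, y_k) for k < j, values at (θ k, z_k) for k < j)` -/
  ψ : (j : Fin i) → (Fin i → Icc a b) × E d × (Fin j → E d) × (Fin j → E d) → E d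
  measurable_ψ : ∀ j, Measurable (ψ j)
  /-- `z_j = χ j (θ, η', values at (t k, y_k) for k ≤ j, values at (θ k, z_k) for k < j)` -/
  χ : (j : Fin i) → (Fin i → Icc a b) × E d × (Fin (j + 1) → E d) × (Fin j → E d) → E d
  measurable_χ : ∀ j, Measurable (χ j)
  /-- the output -/
  φ : (Fin i → Icc a b) × E d × (Fin i → E d) × (Fin i → E d) → Icc a b → E d
  cadlag_φ : ∀ v, IsCadlag (φ v)
  measurable_φ : ∀ s, Measurable fun v => φ v s

namespace Algorithm

variable {a b : ℝ} {d : ℕ} {Ω : Type*} [MeasurableSpace Ω]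

/-- The values of `f'` at `(t 0, y_0), …, (t (k-1), y_{k-1})` and at
`(θ 0, z_0), …, (θ (k-1), z_{k-1})` obtained in the first `k` steps on the data `(η', f')`. -/
def values (A : Algorithm a b d Ω) (η' : E d) (f' : RHS a b d) (ω : Ω) :
    (k : ℕ) → k ≤ A.i → (Fin k → E d) × (Fin k → E d)
  | 0, _ => (Fin.elim0, Fin.elim0)
  | k + 1, hk =>
    let j : Fin A.i := ⟨k, hk⟩
    let θω : Fin A.i → Icc a b := fun m => A.θ m ω
    let u : Fin k → E d := (A.values η' f' ω k (Nat.le_of_succ_le hk)).1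
    let w : Fin k → E d := (A.values η' f' ω k (Nat.le_of_succ_le hk)).2
    let y : E d := A.ψ j (θω, η', u, w)
    let u' : Fin (k + 1) → E d := Fin.snoc (α := fun _ => E d) u (f' (A.t j, y))
    let z : E d := A.χ j (θω, η', u', w)
    (u', Fin.snoc (α := fun _ => E d) w (f' (θω j, z)))

/-- The result of the algorithm on the data `(η', f')`. -/
def output (A : Algorithm a b d Ω) (η' : E d) (f' : RHS a b d) (ω : Ω) : Icc a b → E d :=
  A.φ (fun m => A.θ m ω, η', (A.values η' f' ω A.i le_rfl).1, (A.values η' f' ω A.i le_rfl).2)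

end Algorithm

/-- A randomized method, as a map from the noisy data `(η', f')` and `ω` to functions on `[a,b]`. -/
abbrev Method (a b : ℝ) (d : ℕ) (Ω : Type*) : Type _ :=
  E d → RHS a b d → Ω → Icc a b → E d

/-- `Φ_n`: the methods computed by an algorithm with at most `n` evaluations. -/
def Phi (a b : ℝ) (d : ℕ) (Ω : Type*) [MeasurableSpace Ω] (n : ℕ) : Set (Method a b d Ω) :=
  {M | ∃ A : Algorithm a b d Ω, 2 * A.i ≤ n ∧ M = A.output}

/-- The `L^p(Ω)`-norm of the uniform error of the method `M` for `(η, f)` on the noisy data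
`(η', f')`. -/
def lpError {a b : ℝ} {d : ℕ} {Ω : Type*} [MeasurableSpace Ω] (P : Measure Ω) (p : ℝ)
    (M : Method a b d Ω) (η : E d) (f : RHS a b d) (η' : E d) (f' : RHS a b d) : ℝ≥0∞ :=
  (∫⁻ ω, (⨆ t : Icc a b, ‖sol η f t - M η' f' ω t‖ₑ) ^ p ∂P) ^ (1 / p)

/-- The worst-case error of the method `M` on the class `F^ϱ(K, L)` for precision `δ`. -/
def worstError {a b : ℝ} {d : ℕ} {Ω : Type*} [MeasurableSpace Ω] (P : Measure Ω)
    (K L ϱ p δ : ℝ) (M : Method a b d Ω) : ℝ≥0∞ :=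
  ⨆ (η : E d) (f : RHS a b d) (_ : InClass a b d K L ϱ η f)
    (η' : E d) (f' : RHS a b d) (_ : IsNoisy δ η f η' f'), lpError P p M η f η' f'

/-- The `n`-th minimal error on the class `F^ϱ(K, L)` for precision `δ`. -/
def minError (a b : ℝ) (d : ℕ) {Ω : Type*} [MeasurableSpace Ω] (P : Measure Ω)
    (K L ϱ p : ℝ) (n : ℕ) (δ : ℝ) : ℝ≥0∞ :=
  ⨅ M ∈ Phi a b d Ω n, worstError P K L ϱ p δ M

section RungeKutta

variable {a b : ℝ} (hab : a ≤ b) {d : ℕ}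

/-- The mesh point `a + j h`, `h = (b - a) / m`, as an element of `[a,b]`
(the projection is the identity for `j ≤ m`). -/
def mesh (m j : ℕ) : Icc a b := projIcc a b hab (a + j * ((b - a) / m))

/-- The random point `t_j + s h`, `h = (b - a) / m`, `s ∈ [0,1]`, as an element of `[a,b]`
(the projection is the identity for `j < m`). -/
def randomMesh (m j : ℕ) (s : unitInterval) : Icc a b :=
  projIcc a b hab (a + j * ((b - a) / m) + s * ((b - a) / m))

/-- The values `V^0, V^1, …` of the randomized two-stage Runge–Kutta scheme with `m` steps,
where `s j` is the random number used in the step from `V^j` to `V^{j+1}`. -/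
def rkValue (m : ℕ) (s : ℕ → unitInterval) (η' : E d) (f' : RHS a b d) : ℕ → E d
  | 0 => η'
  | j + 1 =>
    let h : ℝ := (b - a) / m
    let V : E d := rkValue m s η' f' j
    let Vτ : E d := V + (h * (s j : ℝ)) • f' (mesh hab m j, V)
    V + h • f' (randomMesh hab m j (s j), Vτ)

/-- The randomized two-stage Runge–Kutta method with `m` steps: the piecewise linear
interpolation of `V^0, …, V^m` at the mesh points. -/
def rungeKutta {Ω : Type*} (m : ℕ) (τ : ℕ → Ω → unitInterval) : Method a b d Ω :=
  fun η' f' ω t =>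
    let h : ℝ := (b - a) / m
    let V : ℕ → E d := rkValue hab m (fun j => τ j ω) η' f'
    let j : ℕ := min ⌊((t : ℝ) - a) / h⌋₊ (m - 1)
    V j + (((t : ℝ) - (a + j * h)) / h) • (V (j + 1) - V j)

end RungeKutta

end NoisyODE

end

namespace NoisyODE

/-! ### Maximal Hoeffding inequality for sums of independent variables -/

section Maximal

variable {Ω : Type*} [MeasurableSpace Ω] {P : Measure Ω} [IsProbabilityMeasure P]
  {ξ : ℕ → Ω → ℝ} {σ : ℝ}

theorem submartingale_exp_partialSum (hξ : ∀ k, Measurable (ξ k)) (hind : iIndepFun ξ P)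
    (hb : ∀ k ω, |ξ k ω| ≤ σ) (hmean : ∀ k, ∫ ω, ξ k ω ∂P = 0) (r : ℝ) :
    Submartingale (fun k ω => Real.exp (r * ∑ i ∈ Finset.range (k + 1), ξ i ω))
      (Filtration.natural ξ fun k => (hξ k).stronglyMeasurable) P := by
  have hadp : StronglyAdapted (Filtration.natural ξ fun k => (hξ k).stronglyMeasurable)
      (fun k ω => Real.exp (r * ∑ i ∈ Finset.range (k + 1), ξ i ω)) := by
    intro k
    have : StronglyMeasurable[(Filtration.natural ξ fun k => (hξ k).stronglyMeasurable) k]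
        (fun ω => ∑ i ∈ Finset.range (k + 1), ξ i ω) := by
      refine Finset.stronglyMeasurable_fun_sum _ fun i hi => ?_
      exact (Filtration.stronglyAdapted_natural fun k => (hξ k).stronglyMeasurable).stronglyMeasurable_le
        (Nat.lt_succ_iff.1 (Finset.mem_range.1 hi))
    exact Real.continuous_exp.comp_stronglyMeasurable (this.const_mul r)
  have hsumb : ∀ k ω, |∑ i ∈ Finset.range (k + 1), ξ i ω| ≤ (k + 1) * σ := fun k ω => by
    refine (Finset.abs_sum_le_sum_abs _ _).trans ?_
    refine (Finset.sum_le_sum fun i _ => hb i ω).trans ?_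
    simp
  have hint : ∀ k, Integrable (fun ω => Real.exp (r * ∑ i ∈ Finset.range (k + 1), ξ i ω)) P := by
    intro k
    refine Integrable.of_bound (C := Real.exp (|r| * ((k + 1) * σ))) ?_ (ae_of_all _ fun ω => ?_)
    · fun_prop
    · rw [Real.norm_eq_abs, Real.abs_exp, Real.exp_le_exp]
      refine (le_abs_self _).trans ?_
      rw [abs_mul]
      exact mul_le_mul_of_nonneg_left (hsumb k ω) (abs_nonneg _)
  have hint1 : ∀ k, Integrable (fun ω => Real.exp (r * ξ k ω)) P := by
    intro k
    refine Integrable.of_bound (C := Real.exp (|r| * σ)) ?_ (ae_of_all _ fun ω => ?_)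
    · fun_prop
    · rw [Real.norm_eq_abs, Real.abs_exp, Real.exp_le_exp]
      refine (le_abs_self _).trans ?_
      rw [abs_mul]
      exact mul_le_mul_of_nonneg_left (hb k ω) (abs_nonneg _)
  have hintξ : ∀ k, Integrable (ξ k) P := fun k =>
    Integrable.of_bound (C := σ) (hξ k).aestronglyMeasurable (ae_of_all _ fun ω => hb k ω)
  refine submartingale_nat hadp hint fun k => ?_
  have hfac : (fun ω => Real.exp (r * ∑ i ∈ Finset.range (k + 1 + 1), ξ i ω)) =
      (fun ω => Real.exp (r * ∑ i ∈ Finset.range (k + 1), ξ i ω)) *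
        (fun ω => Real.exp (r * ξ (k + 1) ω)) := by
    ext ω
    rw [Finset.sum_range_succ, mul_add, Real.exp_add]
    rfl
  have h1 := condExp_mul_of_stronglyMeasurable_left (μ := P) (hadp k)
    (g := fun ω => Real.exp (r * ξ (k + 1) ω)) (by rw [← hfac]; exact hint (k + 1)) (hint1 (k + 1))
  have h2 : P[(fun ω => Real.exp (r * ξ (k + 1) ω)) |
      (Filtration.natural ξ fun k => (hξ k).stronglyMeasurable) k] =ᵐ[P]
      fun _ => ∫ ω, Real.exp (r * ξ (k + 1) ω) ∂P := by
    refine condExp_indep_eq (hξ (k + 1)).comap_le (Filtration.le _ _) ?_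
      (hind.indep_comap_natural_of_lt (fun k => (hξ k).stronglyMeasurable) k.lt_succ_self)
    exact (Real.measurable_exp.comp ((comap_measurable (ξ (k + 1))).const_mul r)).stronglyMeasurable
  -- Jensen's inequality in the form `1 + x ≤ exp x`; this is where centring enters.
  have h3 : 1 ≤ ∫ ω, Real.exp (r * ξ (k + 1) ω) ∂P := by
    have : ∫ ω, (1 + r * ξ (k + 1) ω) ∂P = 1 := by
      rw [integral_add (integrable_const _) ((hintξ _).const_mul r), integral_const_mul, hmean]
      simp
    rw [← this]
    refine integral_mono ((integrable_const _).add ((hintξ _).const_mul r)) (hint1 _) fun ω => ?_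
    have := Real.add_one_le_exp (r * ξ (k + 1) ω)
    simp only
    linarith
  rw [hfac]
  filter_upwards [h1, h2] with ω h1 h2
  rw [h1, Pi.mul_apply, h2]
  exact le_mul_of_one_le_right (Real.exp_pos _).le h3

/-- **Maximal Hoeffding inequality** for independent centred variables bounded by `σ`. -/
theorem measure_exists_partialSum_ge_le (hξ : ∀ k, Measurable (ξ k)) (hind : iIndepFun ξ P)
    (hσ : 0 < σ) (hb : ∀ k ω, |ξ k ω| ≤ σ) (hmean : ∀ k, ∫ ω, ξ k ω ∂P = 0)
    {m : ℕ} (hm : 0 < m) {x : ℝ} (hx : 0 ≤ x) :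
    P {ω | ∃ j ≤ m, x ≤ ∑ i ∈ Finset.range j, ξ i ω} ≤
      ENNReal.ofReal (Real.exp (-(x ^ 2 / (2 * (m * σ ^ 2))))) := by
  rcases hx.eq_or_lt with rfl | hx
  · simpa using prob_le_one
  -- The submartingale at time `k` contains `k + 1` summands. The empty sum is dealt with
  -- separately, being `0 < x`.
  obtain ⟨m, rfl⟩ : ∃ k, m = k + 1 := ⟨m - 1, by omega⟩
  set v : ℝ := ((m + 1 : ℕ) : ℝ) * σ ^ 2 with hv
  have hv0 : 0 < v := by positivity
  -- Minimizer of the exponent `v * r ^ 2 / 2 - r * x`, with value `-x ^ 2 / (2 * v)`.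
  set r : ℝ := x / v with hr
  have hr0 : 0 < r := by positivity
  have hsub := submartingale_exp_partialSum hξ hind hb hmean r
  have hmax := maximal_ineq hsub (fun k ω => (Real.exp_pos _).le)
    (ε := (Real.exp (r * x)).toNNReal) m
  simp only [Real.coe_toNNReal _ (Real.exp_pos _).le] at hmax
  set A : Set Ω := {ω | Real.exp (r * x) ≤
    (Finset.range (m + 1)).sup' Finset.nonempty_range_add_one
      fun k => Real.exp (r * ∑ i ∈ Finset.range (k + 1), ξ i ω)} with hA
  have hsubset : {ω | ∃ j ≤ m + 1, x ≤ ∑ i ∈ Finset.range j, ξ i ω} ⊆ A := by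
    rintro ω ⟨j, hj, hxj⟩
    rcases j with _ | j
    · simp at hxj; linarith
    · rw [hA, mem_ofPred_eq, Finset.le_sup'_iff]
      refine ⟨j, Finset.mem_range.2 (by omega), ?_⟩
      exact Real.exp_le_exp.2 (mul_le_mul_of_nonneg_left hxj hr0.le)
  have hsg : HasSubgaussianMGF (fun ω => ∑ i ∈ Finset.range (m + 1), ξ i ω)
      (∑ i ∈ Finset.range (m + 1), (‖σ - (-σ)‖₊ / 2) ^ 2) P :=
    HasSubgaussianMGF.sum_of_iIndepFun hind fun i _ =>
      hasSubgaussianMGF_of_mem_Icc_of_integral_eq_zero (hξ i).aemeasurable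
        (ae_of_all _ fun ω => abs_le.1 (hb i ω)) (hmean i)
  have hc : ((∑ i ∈ Finset.range (m + 1), (‖σ - (-σ)‖₊ / 2) ^ 2 : NNReal) : ℝ) = v := by
    simp only [Finset.sum_const, Finset.card_range, hv]
    push_cast
    rw [Real.norm_eq_abs, abs_of_pos (by linarith)]
    simp
  have hmgf : ∫ ω, Real.exp (r * ∑ i ∈ Finset.range (m + 1), ξ i ω) ∂P ≤ Real.exp (v * r ^ 2 / 2) := by
    have := hsg.mgf_le r
    rwa [hc] at this
  have hle : ENNReal.ofReal (Real.exp (r * x)) * P A ≤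
      ENNReal.ofReal (Real.exp (v * r ^ 2 / 2)) := by
    refine hmax.trans (ENNReal.ofReal_le_ofReal ?_)
    refine le_trans ?_ hmgf
    exact setIntegral_le_integral (hsub.integrable m) (ae_of_all _ fun ω => (Real.exp_pos _).le)
  refine (measure_mono hsubset).trans ?_
  have h1 : P A ≤ ENNReal.ofReal (Real.exp (v * r ^ 2 / 2)) / ENNReal.ofReal (Real.exp (r * x)) := by
    rw [ENNReal.le_div_iff_mul_le (Or.inl (by simp [Real.exp_pos])) (Or.inl ENNReal.ofReal_ne_top),
      mul_comm]
    exact hle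
  refine h1.trans (le_of_eq ?_)
  rw [← ENNReal.ofReal_div_of_pos (Real.exp_pos _), ← Real.exp_sub]
  congr 2
  rw [hr]
  field_simp
  ring

theorem measure_exists_abs_partialSum_ge_le (hξ : ∀ k, Measurable (ξ k)) (hind : iIndepFun ξ P)
    (hσ : 0 < σ) (hb : ∀ k ω, |ξ k ω| ≤ σ) (hmean : ∀ k, ∫ ω, ξ k ω ∂P = 0)
    {m : ℕ} (hm : 0 < m) {x : ℝ} (hx : 0 ≤ x) :
    P {ω | ∃ j ≤ m, x ≤ |∑ i ∈ Finset.range j, ξ i ω|} ≤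
      2 * ENNReal.ofReal (Real.exp (-(x ^ 2 / (2 * (m * σ ^ 2))))) := by
  have h1 := measure_exists_partialSum_ge_le hξ hind hσ hb hmean hm hx
  have h2 := measure_exists_partialSum_ge_le (ξ := fun k ω => -ξ k ω) (fun k => (hξ k).neg)
    (hind.comp (fun _ y => -y) fun _ => measurable_neg) hσ (fun k ω => by simpa using hb k ω)
    (fun k => by rw [integral_neg, hmean, neg_zero]) hm hx
  rw [two_mul]
  refine (measure_mono ?_).trans ((measure_union_le _ _).trans (add_le_add h1 h2))
  rintro ω ⟨j, hj, hxj⟩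
  rcases le_abs'.1 hxj with h | h
  · exact Or.inr ⟨j, hj, by rw [Finset.sum_neg_distrib]; linarith⟩
  · exact Or.inl ⟨j, hj, h⟩

end Maximal

end NoisyODE

noncomputable section

namespace NoisyODE

/-! ### Existence and a priori bounds for the exact solution -/

section Retraction

variable {V : Type*} [NormedAddCommGroup V] [NormedSpace ℝ V] {R : ℝ}

/-- The radial retraction onto the closed ball of radius `R` around `0`. -/
def radialRetraction (R : ℝ) (x : V) : V := (R / max R ‖x‖) • x

theorem radialRetraction_of_norm_le (hR : 0 < R) {x : V} (hx : ‖x‖ ≤ R) :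
    radialRetraction R x = x := by
  rw [radialRetraction, max_eq_left hx, div_self hR.ne', one_smul]

theorem norm_radialRetraction_le (hR : 0 < R) (x : V) : ‖radialRetraction R x‖ ≤ R := by
  have h : 0 < max R ‖x‖ := lt_max_of_lt_left hR
  rw [radialRetraction, norm_smul, Real.norm_eq_abs, abs_of_nonneg (by positivity), div_mul_eq_mul_div,
    div_le_iff₀ h]
  exact mul_le_mul_of_nonneg_left (le_max_right _ _) hR.le

theorem norm_radialRetraction_le_norm (hR : 0 < R) (x : V) : ‖radialRetraction R x‖ ≤ ‖x‖ := by
  have h : 0 < max R ‖x‖ := lt_max_of_lt_left hR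
  rw [radialRetraction, norm_smul, Real.norm_eq_abs, abs_of_nonneg (by positivity)]
  exact mul_le_of_le_one_left (norm_nonneg _) ((div_le_one h).2 (le_max_left _ _))

/-- Moving the point and changing the scaling factor each cost at most `‖x - y‖`. In a general
normed space the retraction need not be nonexpansive; any Lipschitz constant is good enough for
Picard–Lindelöf. -/
theorem norm_radialRetraction_sub_le (hR : 0 < R) (x y : V) :
    ‖radialRetraction R x - radialRetraction R y‖ ≤ 2 * ‖x - y‖ := by
  have hx : 0 < max R ‖x‖ := lt_max_of_lt_left hR
  have hy : 0 < max R ‖y‖ := lt_max_of_lt_left hR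
  have e : radialRetraction R x - radialRetraction R y =
      (R / max R ‖x‖) • (x - y) + (R / max R ‖x‖ - R / max R ‖y‖) • y := by
    simp only [radialRetraction, smul_sub, sub_smul]
    abel
  have h1 : ‖(R / max R ‖x‖) • (x - y)‖ ≤ ‖x - y‖ := by
    rw [norm_smul, Real.norm_eq_abs, abs_of_nonneg (by positivity)]
    exact mul_le_of_le_one_left (norm_nonneg _) ((div_le_one hx).2 (le_max_left _ _))
  have h2 : ‖(R / max R ‖x‖ - R / max R ‖y‖) • y‖ ≤ ‖x - y‖ := by
    have e2 : R / max R ‖x‖ - R / max R ‖y‖ =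
        (R / max R ‖x‖) * ((max R ‖y‖ - max R ‖x‖) / max R ‖y‖) := by
      field_simp
    rw [norm_smul, Real.norm_eq_abs, e2, abs_mul, abs_of_nonneg (by positivity : 0 ≤ R / max R ‖x‖),
      abs_div, abs_of_pos hy, mul_assoc]
    refine (mul_le_of_le_one_left (by positivity) ((div_le_one hx).2 (le_max_left _ _))).trans ?_
    rw [div_mul_eq_mul_div, div_le_iff₀ hy]
    have h3 : |max R ‖y‖ - max R ‖x‖| ≤ ‖x - y‖ := by
      refine (abs_max_sub_max_le_max _ _ _ _).trans ?_
      rw [sub_self, abs_zero, max_eq_right (abs_nonneg _), norm_sub_rev]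
      exact abs_norm_sub_norm_le _ _
    exact mul_le_mul h3 (le_max_right _ _) (norm_nonneg _) (norm_nonneg _)
  rw [e]
  linarith [norm_add_le ((R / max R ‖x‖) • (x - y)) ((R / max R ‖x‖ - R / max R ‖y‖) • y)]

end Retraction

section Growth

variable {V : Type*} [NormedAddCommGroup V] [NormedSpace ℝ V] {a b K : ℝ}

/-- Gronwall for `z - η`. The velocity `v` is left arbitrary so that the bound serves both the
original and the truncated equation. -/
theorem norm_sub_le_of_linear_growth (hK : 0 < K) {η : V} {z v : ℝ → V} (hza : z a = η)
    (hz : ∀ t ∈ Icc a b, HasDerivWithinAt z (v t) (Icc a b) t)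
    (hv : ∀ t ∈ Icc a b, ‖v t‖ ≤ K * (1 + ‖η‖ + ‖z t - η‖)) {t : ℝ} (ht : t ∈ Icc a b) :
    ‖z t - η‖ ≤ (1 + ‖η‖) * (Real.exp (K * (b - a)) - 1) := by
  have h := norm_le_gronwallBound_of_norm_deriv_right_le (f := fun s => z s - η) (f' := v)
    (δ := 0) (K := K) (ε := K * (1 + ‖η‖)) (a := a) (b := b)
    (fun s hs => ((hz s hs).continuousWithinAt.sub continuousWithinAt_const))
    (fun s hs => ((hz s (Ico_subset_Icc_self hs)).mono_of_mem_nhdsWithin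
      (Icc_mem_nhdsGE_of_mem hs)).sub_const η)
    (by simp [hza])
    (fun s hs => (hv s (Ico_subset_Icc_self hs)).trans (le_of_eq (by ring))) t ht
  rw [gronwallBound_of_K_ne_0 hK.ne'] at h
  have e : K * (1 + ‖η‖) / K = 1 + ‖η‖ := by field_simp
  simp only [zero_mul, zero_add, e] at h
  refine h.trans (mul_le_mul_of_nonneg_left ?_ (by positivity))
  have : Real.exp (K * (t - a)) ≤ Real.exp (K * (b - a)) :=
    Real.exp_le_exp.2 (mul_le_mul_of_nonneg_left (by linarith [ht.2]) hK.le)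
  linarith

end Growth

section Radius

variable {a b K : ℝ}

theorem growth_radius_le_Rbar (hab : a < b) (hK : 0 < K) :
    (1 + K) * (Real.exp (K * (b - a)) - 1) ≤ Rbar a b K := by
  refine le_trans ?_ (le_max_right _ _)
  have hl : 0 < b - a := sub_pos.2 hab
  have h1 : Real.exp (K * (b - a)) ≤ Real.exp (K * (b - a) * (1 + K * (b - a))) :=
    Real.exp_le_exp.2 (le_mul_of_one_le_right (by positivity) (by nlinarith [mul_pos hK hl]))
  have h0 : 1 ≤ Real.exp (K * (b - a)) := Real.one_le_exp (by positivity)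
  have h2 : 1 ≤ (1 / K + 1) * (1 + K * (b - a)) := by
    have : 0 < 1 / K := by positivity
    nlinarith [mul_pos hK hl, mul_pos this (mul_pos hK hl)]
  have h3 : 0 ≤ Real.exp (K * (b - a) * (1 + K * (b - a))) * (1 + K) - 1 := by nlinarith
  have h4 := mul_le_mul_of_nonneg_right h2 h3
  have h5 : 0 ≤ (b - a) * (1 + K) := by positivity
  nlinarith [mul_le_mul_of_nonneg_right h1 (by linarith : 0 ≤ 1 + K)]

theorem Rbar_pos (hab : a < b) (hK : 0 < K) : 0 < Rbar a b K := by
  refine lt_of_lt_of_le ?_ (growth_radius_le_Rbar hab hK)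
  have : 1 < Real.exp (K * (b - a)) :=
    Real.one_lt_exp_iff.2 (mul_pos hK (sub_pos.2 hab))
  exact mul_pos (by linarith) (by linarith)

end Radius

section Solution

variable {a b : ℝ} {d : ℕ} {K L ϱ : ℝ} {η : E d} {f : RHS a b d} {z : ℝ → E d}

/-- Composing `f` with the retraction onto the ball makes it bounded and globally Lipschitz in
space, so Picard–Lindelöf applies. Linear growth then confines the solution to the ball, where the
truncation does nothing. -/
theorem exists_isSolution (hab : a < b) (hK : 0 < K) (hL : 0 < L)
    (hf : InClass a b d K L ϱ η f) : ∃ z, IsSolution η f z := by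
  have hR := Rbar_pos hab hK
  set R := Rbar a b K with hRdef
  set c : E d → E d := fun x => η + radialRetraction R (x - η) with hc
  have hcball : ∀ x, c x ∈ Metric.closedBall η R := fun x => by
    rw [mem_closedBall_iff_norm, hc, add_sub_cancel_left]
    exact norm_radialRetraction_le hR _
  have hcn : ∀ x, ‖c x‖ ≤ ‖η‖ + ‖x - η‖ := fun x =>
    (norm_add_le _ _).trans (by gcongr; exact norm_radialRetraction_le_norm hR _)
  have hcn' : ∀ x, ‖c x‖ ≤ ‖η‖ + R := fun x =>
    (norm_add_le _ _).trans (by gcongr; exact norm_radialRetraction_le hR _)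
  have hclip : ∀ x y, ‖c x - c y‖ ≤ 2 * ‖x - y‖ := fun x y => by
    have := norm_radialRetraction_sub_le hR (x - η) (y - η)
    simpa [hc] using this
  set F : ℝ → E d → E d := fun t x => f (projIcc a b hab.le t, c x) with hF
  set M : ℝ := K * (1 + (‖η‖ + R)) with hM
  have hM0 : 0 ≤ M := by positivity
  -- The ball radius `M * (b - a)` is what a curve of speed at most `M` can cover, so one
  -- application reaches all of `[a, b]`.
  have hpl : IsPicardLindelof F (⟨a, left_mem_Icc.2 hab.le⟩ : Icc a b) η
      ⟨M * (b - a), mul_nonneg hM0 (sub_nonneg.2 hab.le)⟩ 0 ⟨M, hM0⟩ ⟨L * 2, by positivity⟩ := by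
    refine ⟨fun t _ => ?_, fun x _ => ?_, fun t _ x _ => ?_, ?_⟩
    · refine LipschitzWith.lipschitzOnWith (LipschitzWith.of_dist_le_mul fun x y => ?_)
      rw [dist_eq_norm, dist_eq_norm]
      refine (hf.lipschitz _ _ (hcball x) _ (hcball y)).trans ?_
      change _ ≤ L * 2 * ‖x - y‖
      rw [mul_assoc]
      exact mul_le_mul_of_nonneg_left (hclip x y) hL.le
    · exact (hf.cont.comp (continuous_projIcc.prodMk continuous_const)).continuousOn
    · refine (hf.growth _ _).trans ?_
      change _ ≤ K * (1 + (‖η‖ + R))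
      gcongr
      exact hcn' x
    · change M * max (b - a) (a - a) ≤ M * (b - a) - 0
      rw [sub_self, max_eq_left (sub_nonneg.2 hab.le), sub_zero]
  obtain ⟨z, hza, hz⟩ := hpl.exists_eq_forall_mem_Icc_hasDerivWithinAt₀
  refine ⟨z, hza, fun t => ?_⟩
  have hball : ‖z t - η‖ ≤ R := by
    refine (norm_sub_le_of_linear_growth hK hza hz (fun s _ => ?_) t.2).trans ?_
    · refine (hf.growth _ _).trans ?_
      rw [add_assoc]
      gcongr
      exact hcn _
    · refine le_trans ?_ (growth_radius_le_Rbar hab hK)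
      gcongr
      · linarith [Real.one_le_exp (x := K * (b - a)) (mul_nonneg hK.le (sub_nonneg.2 hab.le))]
      · exact hf.norm_init
  have h := hz t t.2
  have e : F t (z t) = f (t, z t) := by
    simp only [hF, hc, projIcc_val]
    rw [radialRetraction_of_norm_le hR hball, add_sub_cancel]
  rwa [e] at h

/-- The estimates below hold for whichever solution `Classical.epsilon` picks, so uniqueness is
never needed. -/
theorem isSolution_sol (hab : a < b) (hK : 0 < K) (hL : 0 < L)
    (hf : InClass a b d K L ϱ η f) : IsSolution η f (sol η f) :=
  Classical.epsilon_spec (exists_isSolution hab hK hL hf)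

/-- The bound for the slope of solutions of problems in the class. -/
def slopeBound (a b K : ℝ) : ℝ := K * (1 + K + Rbar a b K)

/-- The Hölder constant of the slope of solutions of problems in the class. -/
def slopeHolder (a b K L ϱ : ℝ) : ℝ := L * (1 + slopeBound a b K * (b - a) ^ (1 - ϱ))

theorem slopeBound_pos (hab : a < b) (hK : 0 < K) : 0 < slopeBound a b K := by
  have := Rbar_pos hab hK
  unfold slopeBound
  positivity

theorem slopeHolder_pos (hab : a < b) (hK : 0 < K) (hL : 0 < L) : 0 < slopeHolder a b K L ϱ := by
  have := slopeBound_pos hab hK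
  have := sub_pos.2 hab
  unfold slopeHolder
  positivity

namespace IsSolution

theorem mem_closedBall (hz : IsSolution η f z) (hab : a < b) (hK : 0 < K)
    (hf : InClass a b d K L ϱ η f) (t : Icc a b) : z t ∈ Metric.closedBall η (Rbar a b K) := by
  rw [mem_closedBall_iff_norm]
  have hz' : ∀ s ∈ Icc a b, HasDerivWithinAt z (f (projIcc a b hab.le s, z s)) (Icc a b) s := by
    intro s hs
    rw [projIcc_of_mem hab.le hs]
    exact hz.2 ⟨s, hs⟩
  refine (norm_sub_le_of_linear_growth hK hz.1 hz' (fun s _ => ?_) t.2).trans ?_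
  · refine (hf.growth _ _).trans ?_
    rw [add_assoc]
    gcongr
    have := norm_add_le η (z s - η)
    rwa [add_sub_cancel] at this
  · refine le_trans ?_ (growth_radius_le_Rbar hab hK)
    gcongr
    · linarith [Real.one_le_exp (x := K * (b - a)) (mul_nonneg hK.le (sub_nonneg.2 hab.le))]
    · exact hf.norm_init

theorem norm_slope_le (hz : IsSolution η f z) (hab : a < b) (hK : 0 < K)
    (hf : InClass a b d K L ϱ η f) (t : Icc a b) : ‖f (t, z t)‖ ≤ slopeBound a b K := by
  refine (hf.growth _ _).trans ?_
  have h1 := mem_closedBall_iff_norm.1 (hz.mem_closedBall hab hK hf t)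
  have h2 := norm_add_le η (z t - η)
  rw [add_sub_cancel] at h2
  have := hf.norm_init
  unfold slopeBound
  exact mul_le_mul_of_nonneg_left (by linarith) hK.le

theorem norm_sub_le (hz : IsSolution η f z) (hab : a < b) (hK : 0 < K)
    (hf : InClass a b d K L ϱ η f) (s t : Icc a b) :
    ‖z t - z s‖ ≤ slopeBound a b K * |(t : ℝ) - s| := by
  have hz' : ∀ s ∈ Icc a b, HasDerivWithinAt z (f (projIcc a b hab.le s, z s)) (Icc a b) s := by
    intro s hs
    rw [projIcc_of_mem hab.le hs]
    exact hz.2 ⟨s, hs⟩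
  refine (convex_Icc a b).norm_image_sub_le_of_norm_hasDerivWithin_le hz' (fun x hx => ?_) s.2 t.2
  rw [projIcc_of_mem hab.le hx]
  exact hz.norm_slope_le hab hK hf ⟨x, hx⟩

theorem continuous_restrict (hz : IsSolution η f z) : Continuous fun t : Icc a b => z t :=
  continuousOn_iff_continuous_domRestrict.1 fun t ht => (hz.2 ⟨t, ht⟩).continuousWithinAt

/-- Hölder in time plus Lipschitz in space along the Lipschitz curve `z`; on a bounded interval `|t
- s|` is dominated by `(b - a) ^ (1 - ϱ) * |t - s| ^ ϱ`. -/
theorem norm_slope_sub_le (hz : IsSolution η f z) (hab : a < b) (hK : 0 < K) (hL : 0 < L)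
    (hϱ1 : ϱ ≤ 1) (hf : InClass a b d K L ϱ η f) (s t : Icc a b) :
    ‖f (t, z t) - f (s, z s)‖ ≤ slopeHolder a b K L ϱ * |(t : ℝ) - s| ^ ϱ := by
  have h1 := hf.holder t s (z t) (hz.mem_closedBall hab hK hf t)
  have h2 := hf.lipschitz s (z t) (hz.mem_closedBall hab hK hf t) (z s)
    (hz.mem_closedBall hab hK hf s)
  have h3 := hz.norm_sub_le hab hK hf s t
  have hl : |(t : ℝ) - s| ≤ b - a := by
    rw [abs_le]; constructor <;> linarith [t.2.1, t.2.2, s.2.1, s.2.2]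
  have h4 : |(t : ℝ) - s| ≤ (b - a) ^ (1 - ϱ) * |(t : ℝ) - s| ^ ϱ := by
    rcases (abs_nonneg ((t : ℝ) - s)).eq_or_lt with h | h
    · rw [← h]
      exact mul_nonneg (Real.rpow_nonneg (sub_nonneg.2 hab.le) _) (Real.rpow_nonneg le_rfl _)
    · calc |(t : ℝ) - s| = |(t : ℝ) - s| ^ (1 - ϱ) * |(t : ℝ) - s| ^ ϱ := by
            rw [← Real.rpow_add h]; simp
        _ ≤ _ := by
            gcongr
  have hM := slopeBound_pos hab hK
  calc ‖f (t, z t) - f (s, z s)‖ = ‖(f (t, z t) - f (s, z t)) + (f (s, z t) - f (s, z s))‖ := by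
        rw [sub_add_sub_cancel]
    _ ≤ L * |(t : ℝ) - s| ^ ϱ + L * (slopeBound a b K * |(t : ℝ) - s|) :=
        (norm_add_le _ _).trans (add_le_add h1 (h2.trans (mul_le_mul_of_nonneg_left h3 hL.le)))
    _ ≤ L * |(t : ℝ) - s| ^ ϱ +
          L * (slopeBound a b K * ((b - a) ^ (1 - ϱ) * |(t : ℝ) - s| ^ ϱ)) := by gcongr
    _ = _ := by unfold slopeHolder; ring

/-- Mean value inequality for `x ↦ z x - x • f (u, z u)`, whose derivative is a difference of
slopes. It is used with `u` the left end point (predictor, interpolation) and with `u` the random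
node (defect). -/
theorem norm_sub_sub_smul_le (hz : IsSolution η f z) (hab : a < b) (hK : 0 < K) (hL : 0 < L)
    (hϱ0 : 0 < ϱ) (hϱ1 : ϱ ≤ 1) (hf : InClass a b d K L ϱ η f) {s t u : Icc a b}
    (hsu : s ≤ u) (hut : u ≤ t) {h : ℝ} (hh : 0 < h) (hth : (t : ℝ) - s ≤ h) :
    ‖z t - z s - ((t : ℝ) - s) • f (u, z u)‖ ≤ slopeHolder a b K L ϱ * h ^ (1 + ϱ) := by
  have hst : (s : ℝ) ≤ t := hsu.trans hut
  have hsub : Icc (s : ℝ) t ⊆ Icc a b := Icc_subset_Icc s.2.1 t.2.2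
  have hz' : ∀ x ∈ Icc (s : ℝ) t, HasDerivWithinAt (fun x => z x - x • f (u, z u))
      (f (projIcc a b hab.le x, z x) - f (u, z u)) (Icc (s : ℝ) t) x := by
    intro x hx
    rw [projIcc_of_mem hab.le (hsub hx)]
    have h1 := (hz.2 ⟨x, hsub hx⟩).mono hsub
    have h2 := ((hasDerivWithinAt_id x (Icc (s : ℝ) t)).smul_const (f (u, z u)))
    rw [one_smul] at h2
    exact h1.sub h2
  have hC := slopeHolder_pos (ϱ := ϱ) hab hK hL
  have hmv := (convex_Icc (s : ℝ) t).norm_image_sub_le_of_norm_hasDerivWithin_le hz'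
    (C := slopeHolder a b K L ϱ * h ^ ϱ) (fun x hx => ?_) (left_mem_Icc.2 hst) (right_mem_Icc.2 hst)
  · have e : z t - z s - ((t : ℝ) - s) • f (u, z u) =
        z t - (t : ℝ) • f (u, z u) - (z s - (s : ℝ) • f (u, z u)) := by
      rw [sub_smul]; abel
    rw [e]
    refine hmv.trans ?_
    rw [Real.norm_eq_abs, abs_of_nonneg (sub_nonneg.2 hst), Real.rpow_add hh, Real.rpow_one,
      mul_assoc, mul_comm (h ^ ϱ)]
    gcongr
  · rw [projIcc_of_mem hab.le (hsub hx)]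
    refine (hz.norm_slope_sub_le hab hK hL hϱ1 hf u ⟨x, hsub hx⟩).trans ?_
    gcongr
    have h1 : (s : ℝ) ≤ u := hsu
    have h2 : (u : ℝ) ≤ t := hut
    rw [abs_le]
    constructor <;> simp only <;> linarith [hx.1, hx.2]

end IsSolution

end Solution

end NoisyODE

end

noncomputable section

namespace NoisyODE

/-! ### Pathwise error analysis of the Runge–Kutta scheme -/

section Mesh

variable {a b : ℝ} {m j : ℕ}

theorem coe_mesh (hab : a ≤ b) (hm : 0 < m) (hj : j ≤ m) :
    (mesh hab m j : ℝ) = a + j * ((b - a) / m) := by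
  have hm' : (0 : ℝ) < m := Nat.cast_pos.2 hm
  have hj' : (j : ℝ) ≤ m := Nat.cast_le.2 hj
  have hl : 0 ≤ b - a := sub_nonneg.2 hab
  have h1 : 0 ≤ (j : ℝ) * ((b - a) / m) := by positivity
  have h2 : (j : ℝ) * ((b - a) / m) ≤ b - a := by
    calc (j : ℝ) * ((b - a) / m) ≤ m * ((b - a) / m) := by gcongr
      _ = b - a := by field_simp
  rw [mesh, projIcc_of_mem hab ⟨by linarith, by linarith⟩]

theorem coe_randomMesh (hab : a ≤ b) (hj : j < m) (s : unitInterval) :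
    (randomMesh hab m j s : ℝ) = a + j * ((b - a) / m) + s * ((b - a) / m) := by
  have hm' : (0 : ℝ) < m := Nat.cast_pos.2 (by omega)
  have hj' : (j : ℝ) + 1 ≤ m := by exact_mod_cast hj
  have hl : 0 ≤ b - a := sub_nonneg.2 hab
  have hh : 0 ≤ (b - a) / m := by positivity
  have h1 : 0 ≤ (j : ℝ) * ((b - a) / m) := by positivity
  have h2 : ((j : ℝ) + 1) * ((b - a) / m) ≤ b - a := by
    calc ((j : ℝ) + 1) * ((b - a) / m) ≤ m * ((b - a) / m) := by gcongr
      _ = b - a := by field_simp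
  have h3 : 0 ≤ (s : ℝ) * ((b - a) / m) := mul_nonneg s.2.1 hh
  have h4 : (s : ℝ) * ((b - a) / m) ≤ (b - a) / m := mul_le_of_le_one_left hh s.2.2
  rw [randomMesh, projIcc_of_mem hab ⟨by linarith, by linarith⟩]

/-- The index of the mesh interval that contains `t`. -/
theorem mesh_index_spec (hab : a < b) (hm : 0 < m) (t : Icc a b) {j : ℕ}
    (hj : j = min ⌊((t : ℝ) - a) / ((b - a) / m)⌋₊ (m - 1)) :
    j < m ∧ a + j * ((b - a) / m) ≤ t ∧ (t : ℝ) ≤ a + (j + 1 : ℕ) * ((b - a) / m) := by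
  have hm' : (0 : ℝ) < m := Nat.cast_pos.2 hm
  have hh : 0 < (b - a) / m := div_pos (sub_pos.2 hab) hm'
  have hta : 0 ≤ ((t : ℝ) - a) / ((b - a) / m) := div_nonneg (sub_nonneg.2 t.2.1) hh.le
  refine ⟨by omega, ?_, ?_⟩
  · have h1 : (j : ℝ) ≤ ((t : ℝ) - a) / ((b - a) / m) :=
      le_trans (Nat.cast_le.2 (by omega)) (Nat.floor_le hta)
    rw [le_div_iff₀ hh] at h1
    linarith
  · rcases le_total ⌊((t : ℝ) - a) / ((b - a) / m)⌋₊ (m - 1) with h | h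
    · rw [min_eq_left h] at hj
      have h1 := Nat.lt_floor_add_one (((t : ℝ) - a) / ((b - a) / m))
      rw [div_lt_iff₀ hh, ← hj] at h1
      push_cast
      linarith
    -- The capped case, which includes `t = b`, where the floor equals `m`; the last interval ends
    -- at `b`.
    · rw [min_eq_right h] at hj
      have : j + 1 = m := by omega
      rw [this, mul_div_cancel₀ _ hm'.ne']
      linarith [t.2.2]

end Mesh

section Pathwise

variable {a b : ℝ} {d : ℕ} {K L ϱ δ : ℝ} {η η' : E d} {f f' : RHS a b d} {z : ℝ → E d}
  {m : ℕ} {s : ℕ → unitInterval}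

/-- The intermediate value in the step from `V^j` to `V^{j+1}` of the Runge–Kutta scheme. -/
def rkStage (hab : a ≤ b) (m : ℕ) (s : ℕ → unitInterval) (η' : E d) (f' : RHS a b d) (j : ℕ) :
    E d :=
  rkValue hab m s η' f' j +
    ((b - a) / m * (s j : ℝ)) • f' (mesh hab m j, rkValue hab m s η' f' j)

theorem rkValue_succ (hab : a ≤ b) (j : ℕ) :
    rkValue hab m s η' f' (j + 1) = rkValue hab m s η' f' j +
      ((b - a) / m) • f' (randomMesh hab m j (s j), rkStage hab m s η' f' j) := rfl

theorem IsNoisy.norm_sub_le (h : IsNoisy δ η f η' f') (q : Icc a b × E d) : ‖f' q - f q‖ ≤ δ := by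
  obtain ⟨-, e, -, he, rfl⟩ := h
  simpa using he q

/-- Noise of size at most `1 = K * (1 / K)` is absorbed into the growth constant; this is the origin
of `1 / K` in `Rbar`. -/
theorem IsNoisy.norm_le (h : IsNoisy δ η f η' f') (hδ : δ ≤ 1) (hK : 0 < K)
    (hf : InClass a b d K L ϱ η f) (t : Icc a b) (x : E d) :
    ‖f' (t, x)‖ ≤ K * (1 + K + 1 / K + ‖x - η‖) := by
  have h1 := h.norm_sub_le (t, x)
  have h2 := hf.growth t x
  have h3 : ‖f' (t, x)‖ ≤ ‖f (t, x)‖ + ‖f' (t, x) - f (t, x)‖ := by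
    have := norm_add_le (f (t, x)) (f' (t, x) - f (t, x))
    rwa [add_sub_cancel] at this
  have h4 : ‖x‖ ≤ K + ‖x - η‖ := by
    have := norm_add_le η (x - η)
    rw [add_sub_cancel] at this
    linarith [hf.norm_init]
  have h5 : K * (1 + ‖x‖) ≤ K * (1 + (K + ‖x - η‖)) := by gcongr
  have h6 : K * (1 + K + 1 / K + ‖x - η‖) = K * (1 + (K + ‖x - η‖)) + 1 := by field_simp; ring
  linarith

theorem norm_rkStage_sub_le (hab : a < b) (hK : 0 < K) (hδ : δ ≤ 1)
    (hf : InClass a b d K L ϱ η f) (hn : IsNoisy δ η f η' f') (j : ℕ) :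
    ‖rkStage hab.le m s η' f' j - η‖ ≤ ‖rkValue hab.le m s η' f' j - η‖ +
      (b - a) / m * (K * (1 + K + 1 / K + ‖rkValue hab.le m s η' f' j - η‖)) := by
  have hh : 0 ≤ (b - a) / m := div_nonneg (sub_pos.2 hab).le (Nat.cast_nonneg m)
  rw [rkStage, add_sub_right_comm]
  refine (norm_add_le _ _).trans ?_
  gcongr
  rw [norm_smul, Real.norm_eq_abs, abs_of_nonneg (mul_nonneg hh (s j).2.1)]
  refine mul_le_mul (mul_le_of_le_one_right hh (s j).2.2) (hn.norm_le hδ hK hf _ _)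
    (norm_nonneg _) hh

/-- Adding `1 + K + 1 / K` makes the recursion for the distance to `η` homogeneous: each two-stage
step multiplies by at most `1 + h K (1 + h K)`. The start is at most `δ ≤ 1`. -/
theorem norm_rkValue_sub_add_le (hab : a < b) (hK : 0 < K) (hδ : δ ≤ 1)
    (hf : InClass a b d K L ϱ η f) (hn : IsNoisy δ η f η' f') (j : ℕ) :
    ‖rkValue hab.le m s η' f' j - η‖ + (1 + K + 1 / K) ≤
      (1 + (b - a) / m * K * (1 + (b - a) / m * K)) ^ j * (2 + K + 1 / K) := by
  have hh : 0 ≤ (b - a) / m := div_nonneg (sub_pos.2 hab).le (Nat.cast_nonneg m)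
  induction j with
  | zero =>
    have := mem_closedBall_iff_norm.1 hn.1
    rw [rkValue, pow_zero]
    linarith
  | succ j ih =>
    have h1 := norm_rkStage_sub_le (m := m) (s := s) hab hK hδ hf hn j
    rw [rkValue_succ, add_sub_right_comm]
    have h2 : ‖((b - a) / m) • f' (randomMesh hab.le m j (s j), rkStage hab.le m s η' f' j)‖ ≤
        (b - a) / m * (K * (1 + K + 1 / K + ‖rkStage hab.le m s η' f' j - η‖)) := by
      rw [norm_smul, Real.norm_eq_abs, abs_of_nonneg hh]
      exact mul_le_mul_of_nonneg_left (hn.norm_le hδ hK hf _ _) hh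
    have h3 := norm_add_le (rkValue hab.le m s η' f' j - η)
      (((b - a) / m) • f' (randomMesh hab.le m j (s j), rkStage hab.le m s η' f' j))
    set D := ‖rkValue hab.le m s η' f' j - η‖
    set h := (b - a) / (m : ℝ)
    have h4 : h * (K * (1 + K + 1 / K + ‖rkStage hab.le m s η' f' j - η‖)) ≤
        h * (K * (1 + K + 1 / K + (D + h * (K * (1 + K + 1 / K + D))))) := by gcongr
    have h5 := mul_le_mul_of_nonneg_left ih (by positivity : 0 ≤ 1 + h * K * (1 + h * K))
    rw [pow_succ', mul_assoc]
    refine le_trans ?_ h5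
    nlinarith

theorem norm_rkValue_sub_add_le_exp (hab : a < b) (hm : 0 < m) (hK : 0 < K) (hδ : δ ≤ 1)
    (hf : InClass a b d K L ϱ η f) (hn : IsNoisy δ η f η' f') {j : ℕ} (hj : j ≤ m) :
    ‖rkValue hab.le m s η' f' j - η‖ + (1 + K + 1 / K) ≤
      Real.exp (K * (b - a) * (1 + K * (b - a))) * (2 + K + 1 / K) := by
  refine (norm_rkValue_sub_add_le hab hK hδ hf hn j).trans ?_
  have hm' : (0 : ℝ) < m := Nat.cast_pos.2 hm
  have hm1 : (1 : ℝ) ≤ m := by exact_mod_cast hm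
  have hl : 0 < b - a := sub_pos.2 hab
  have hh : 0 ≤ (b - a) / m := div_nonneg hl.le (Nat.cast_nonneg m)
  have hhl : (b - a) / m ≤ b - a := div_le_self hl.le hm1
  gcongr
  calc (1 + (b - a) / m * K * (1 + (b - a) / m * K)) ^ j
      ≤ Real.exp ((b - a) / m * K * (1 + (b - a) / m * K)) ^ j := by
        gcongr
        rw [add_comm]
        exact Real.add_one_le_exp _
    _ = Real.exp (j * ((b - a) / m * K * (1 + (b - a) / m * K))) := (Real.exp_nat_mul _ _).symm
    _ ≤ _ := by
        rw [Real.exp_le_exp]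
        calc (j : ℝ) * ((b - a) / m * K * (1 + (b - a) / m * K))
            ≤ m * ((b - a) / m * K * (1 + (b - a) * K)) := by gcongr
          _ = K * (b - a) * (1 + K * (b - a)) := by field_simp

/-- As `(1 / K + 1) * (1 + K) = 2 + K + 1 / K`, the second entry of the maximum in `Rbar` exceeds
the left-hand side by exactly `2 * K`. The left-hand side bounds a stage: one further factor `1 + K
* (b - a)` on the bound for the values. -/
theorem rkStage_bound_le_Rbar (a b : ℝ) (hK : 0 < K) :
    (1 + K * (b - a)) * (Real.exp (K * (b - a) * (1 + K * (b - a))) * (2 + K + 1 / K)) -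
      (1 + K + 1 / K) ≤ Rbar a b K := by
  refine le_trans ?_ (le_max_right _ _)
  have e : (1 / K + 1) * (1 + K * (b - a)) *
        (Real.exp (K * (b - a) * (1 + K * (b - a))) * (1 + K) - 1) =
      (1 + K * (b - a)) * (Real.exp (K * (b - a) * (1 + K * (b - a))) * (2 + K + 1 / K)) -
        (1 / K + 1 + (b - a) + K * (b - a)) := by
    field_simp
    ring
  rw [e]
  linarith

theorem rkValue_mem_closedBall (hab : a < b) (hm : 0 < m) (hK : 0 < K) (hδ : δ ≤ 1)
    (hf : InClass a b d K L ϱ η f) (hn : IsNoisy δ η f η' f') {j : ℕ} (hj : j ≤ m) :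
    rkValue hab.le m s η' f' j ∈ Metric.closedBall η (Rbar a b K) := by
  rw [mem_closedBall_iff_norm]
  refine le_trans ?_ (rkStage_bound_le_Rbar a b hK)
  have h1 := norm_rkValue_sub_add_le_exp (s := s) hab hm hK hδ hf hn hj
  have hl : 0 < b - a := sub_pos.2 hab
  have h2 : 0 ≤ K * (b - a) * (Real.exp (K * (b - a) * (1 + K * (b - a))) * (2 + K + 1 / K)) := by
    positivity
  linarith

theorem rkStage_mem_closedBall (hab : a < b) (hm : 0 < m) (hK : 0 < K) (hδ : δ ≤ 1)
    (hf : InClass a b d K L ϱ η f) (hn : IsNoisy δ η f η' f') {j : ℕ} (hj : j ≤ m) :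
    rkStage hab.le m s η' f' j ∈ Metric.closedBall η (Rbar a b K) := by
  rw [mem_closedBall_iff_norm]
  refine le_trans ?_ (rkStage_bound_le_Rbar a b hK)
  have hm1 : (1 : ℝ) ≤ m := by exact_mod_cast hm
  have hl : 0 < b - a := sub_pos.2 hab
  have hhl : (b - a) / m ≤ b - a := div_le_self hl.le hm1
  have h1 := norm_rkValue_sub_add_le_exp (s := s) hab hm hK hδ hf hn hj
  have h2 := norm_rkStage_sub_le (m := m) (s := s) hab hK hδ hf hn j
  set D := ‖rkValue hab.le m s η' f' j - η‖ with hD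
  have hD0 : 0 ≤ D := norm_nonneg _
  have h3 : (b - a) / m * (K * (1 + K + 1 / K + D)) ≤ (b - a) * (K * (1 + K + 1 / K + D)) := by
    gcongr
  have h4 := mul_le_mul_of_nonneg_left h1 (by positivity : 0 ≤ 1 + K * (b - a))
  nlinarith

/-- The quadrature error of the exact slope in one step of the Runge–Kutta scheme. -/
def stepDefect (hab : a ≤ b) (f : RHS a b d) (z : ℝ → E d) (m j : ℕ) (s : unitInterval) : E d :=
  z (mesh hab m (j + 1)) - z (mesh hab m j) -
    ((b - a) / m) • f (randomMesh hab m j s, z (randomMesh hab m j s))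

theorem norm_stepDefect_le (hab : a < b) (hm : 0 < m) (hK : 0 < K) (hL : 0 < L)
    (hϱ0 : 0 < ϱ) (hϱ1 : ϱ ≤ 1) (hf : InClass a b d K L ϱ η f) (hz : IsSolution η f z)
    {j : ℕ} (hj : j < m) (u : unitInterval) :
    ‖stepDefect hab.le f z m j u‖ ≤ slopeHolder a b K L ϱ * ((b - a) / m) ^ (1 + ϱ) := by
  have hh : 0 < (b - a) / m := div_pos (sub_pos.2 hab) (Nat.cast_pos.2 hm)
  have e1 := coe_mesh hab.le hm hj.le
  have e2 := coe_mesh hab.le hm (Nat.succ_le_of_lt hj)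
  have e3 := coe_randomMesh hab.le hj u
  have h4 : 0 ≤ (u : ℝ) * ((b - a) / m) := mul_nonneg u.2.1 hh.le
  have h5 : (u : ℝ) * ((b - a) / m) ≤ (b - a) / m := mul_le_of_le_one_left hh.le u.2.2
  push_cast at e2
  have key : ((mesh hab.le m (j + 1) : Icc a b) : ℝ) - mesh hab.le m j = (b - a) / m := by
    rw [e1, e2]; ring
  have := hz.norm_sub_sub_smul_le hab hK hL hϱ0 hϱ1 hf (s := mesh hab.le m j)
    (u := randomMesh hab.le m j u) (t := mesh hab.le m (j + 1)) (h := (b - a) / m)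
    (Subtype.coe_le_coe.1 (by rw [e1, e3]; linarith))
    (Subtype.coe_le_coe.1 (by rw [e2, e3]; linarith)) hh key.le
  rwa [key] at this

theorem norm_noisy_slope_sub_le (hab : a < b) (hm : 0 < m) (hK : 0 < K) (hL : 0 < L)
    (hϱ0 : 0 < ϱ) (hϱ1 : ϱ ≤ 1) (hδ : δ ≤ 1) (hf : InClass a b d K L ϱ η f)
    (hn : IsNoisy δ η f η' f') (hz : IsSolution η f z) {j : ℕ} (hj : j < m) :
    ‖f (randomMesh hab.le m j (s j), z (randomMesh hab.le m j (s j))) -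
        f' (randomMesh hab.le m j (s j), rkStage hab.le m s η' f' j)‖ ≤
      L * (1 + (b - a) * L) * ‖z (mesh hab.le m j) - rkValue hab.le m s η' f' j‖ +
        (L * (slopeHolder a b K L ϱ * ((b - a) / m) ^ (1 + ϱ) + (b - a) * δ) + δ) := by
  have hm1 : (1 : ℝ) ≤ m := by exact_mod_cast hm
  have hl : 0 < b - a := sub_pos.2 hab
  have hhl : (b - a) / m ≤ b - a := div_le_self hl.le hm1
  have hh : 0 < (b - a) / m := div_pos hl (Nat.cast_pos.2 hm)
  set V := rkValue hab.le m s η' f' j with hV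
  set t₀ := mesh hab.le m j with ht₀
  set θ := randomMesh hab.le m j (s j) with hθ
  have e1 := coe_mesh hab.le hm hj.le
  have e3 := coe_randomMesh hab.le hj (s j)
  have h4 : 0 ≤ (s j : ℝ) * ((b - a) / m) := mul_nonneg (s j).2.1 hh.le
  have h5 : (s j : ℝ) * ((b - a) / m) ≤ (b - a) / m := mul_le_of_le_one_left hh.le (s j).2.2
  have key : (θ : ℝ) - t₀ = (b - a) / m * s j := by rw [e1, e3]; ring
  have hle : t₀ ≤ θ := Subtype.coe_le_coe.1 (by rw [e1, e3]; linarith)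
  have h1 := hz.norm_sub_sub_smul_le hab hK hL hϱ0 hϱ1 hf (s := t₀) (u := t₀) (t := θ)
    (h := (b - a) / m) le_rfl hle hh (by rw [key, mul_comm]; exact h5)
  rw [key] at h1
  have hVb := rkValue_mem_closedBall (s := s) hab hm hK hδ hf hn hj.le
  have hSb := rkStage_mem_closedBall (s := s) hab hm hK hδ hf hn hj.le
  have h2 : ‖f (t₀, z t₀) - f' (t₀, V)‖ ≤ L * ‖z t₀ - V‖ + δ := by
    have q1 := hf.lipschitz t₀ _ (hz.mem_closedBall hab hK hf t₀) _ hVb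
    have q2 := hn.norm_sub_le (t₀, V)
    rw [norm_sub_rev] at q2
    have := norm_add_le (f (t₀, z t₀) - f (t₀, V)) (f (t₀, V) - f' (t₀, V))
    rw [sub_add_sub_cancel] at this
    linarith
  have h3 : ‖z θ - rkStage hab.le m s η' f' j‖ ≤
      (1 + (b - a) * L) * ‖z t₀ - V‖ +
        (slopeHolder a b K L ϱ * ((b - a) / m) ^ (1 + ϱ) + (b - a) * δ) := by
    -- Predictor error: error inherited from the mesh point, Taylor remainder of the exact solution,
    -- slope error at the mesh point.
    have e : z θ - rkStage hab.le m s η' f' j = (z t₀ - V) +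
        (z θ - z t₀ - ((b - a) / m * s j) • f (t₀, z t₀)) +
        ((b - a) / m * s j) • (f (t₀, z t₀) - f' (t₀, V)) := by
      rw [rkStage, smul_sub]
      abel
    have q : ‖((b - a) / m * s j) • (f (t₀, z t₀) - f' (t₀, V))‖ ≤
        (b - a) * (L * ‖z t₀ - V‖ + δ) := by
      rw [norm_smul, Real.norm_eq_abs, abs_of_nonneg (mul_nonneg hh.le (s j).2.1)]
      refine mul_le_mul (by rw [mul_comm]; linarith) h2 (norm_nonneg _) hl.le
    rw [e]
    refine (norm_add₃_le).trans ?_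
    linarith
  have h6 := hf.lipschitz θ _ (hz.mem_closedBall hab hK hf θ) _ hSb
  have h7 := hn.norm_sub_le (θ, rkStage hab.le m s η' f' j)
  rw [norm_sub_rev] at h7
  have h8 := norm_add_le (f (θ, z θ) - f (θ, rkStage hab.le m s η' f' j))
    (f (θ, rkStage hab.le m s η' f' j) - f' (θ, rkStage hab.le m s η' f' j))
  rw [sub_add_sub_cancel] at h8
  have h9 := mul_le_mul_of_nonneg_left h3 hL.le
  linarith

/-- Telescoping. The defects are evaluated along the exact solution, not the numerical one: this
keeps them independent of each other and puts all dependence on the past and on the noise into the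
last sum. -/
theorem sol_sub_rkValue (hab : a < b) (hz : IsSolution η f z) (j : ℕ) :
    z (mesh hab.le m j) - rkValue hab.le m s η' f' j = (η - η') +
      ∑ k ∈ Finset.range j, stepDefect hab.le f z m k (s k) +
      ∑ k ∈ Finset.range j, ((b - a) / m) •
        (f (randomMesh hab.le m k (s k), z (randomMesh hab.le m k (s k))) -
          f' (randomMesh hab.le m k (s k), rkStage hab.le m s η' f' k)) := by
  induction j with
  | zero =>
    have : (mesh hab.le m 0 : ℝ) = a := by
      rw [mesh]
      simp
    simp [this, hz.1, rkValue]
  | succ j ih =>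
    rw [Finset.sum_range_succ, Finset.sum_range_succ, rkValue_succ]
    have e : z (mesh hab.le m (j + 1)) - (rkValue hab.le m s η' f' j +
        ((b - a) / m) • f' (randomMesh hab.le m j (s j), rkStage hab.le m s η' f' j)) =
        (z (mesh hab.le m j) - rkValue hab.le m s η' f' j) + stepDefect hab.le f z m j (s j) +
        ((b - a) / m : ℝ) •
        (f (randomMesh hab.le m j (s j), z (randomMesh hab.le m j (s j))) -
          f' (randomMesh hab.le m j (s j), rkStage hab.le m s η' f' j)) := by
      rw [stepDefect, smul_sub]
      abel
    rw [e, ih]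
    abel

/-- Discrete Gronwall inequality. The induction runs on the majorant on the right of `hu`, since `u`
itself satisfies no recursion. -/
theorem le_mul_exp_of_le_add_sum {u : ℕ → ℝ} {D h α β : ℝ} (hD : 0 ≤ D) (hh : 0 ≤ h) (hα : 0 ≤ α)
    (hβ : 0 ≤ β) {m : ℕ}
    (hu : ∀ j ≤ m, u j ≤ D + ∑ k ∈ Finset.range j, h * (α * u k + β)) {j : ℕ} (hj : j ≤ m) :
    u j ≤ (D + m * (h * β)) * Real.exp (m * (h * α)) := by
  have h1 : ∀ j ≤ m, u j ≤ (D + j * (h * β)) * (1 + h * α) ^ j := by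
    have h2 : ∀ j ≤ m, D + ∑ k ∈ Finset.range j, h * (α * u k + β) ≤
        (D + j * (h * β)) * (1 + h * α) ^ j := by
      intro j
      induction j with
      | zero => simp
      | succ j ih =>
        intro hj
        have i1 := ih (by omega)
        have i2 := hu j (by omega)
        rw [Finset.sum_range_succ, ← add_assoc]
        have i3 : h * (α * u j + β) ≤ h * (α * ((D + j * (h * β)) * (1 + h * α) ^ j) + β) := by
          gcongr
          exact i2.trans i1
        have i4 : 1 ≤ (1 + h * α) ^ (j + 1) := one_le_pow₀ (by nlinarith [mul_nonneg hh hα])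
        have i5 := mul_le_mul_of_nonneg_left i4 (mul_nonneg hh hβ)
        push_cast
        rw [pow_succ] at i5 ⊢
        nlinarith
    exact fun j hj => (hu j hj).trans (h2 j hj)
  refine (h1 j hj).trans ?_
  have hj' : (j : ℝ) ≤ m := Nat.cast_le.2 hj
  gcongr
  calc (1 + h * α) ^ j ≤ Real.exp (h * α) ^ j := by
        gcongr
        rw [add_comm]
        exact Real.add_one_le_exp _
    _ = Real.exp (j * (h * α)) := (Real.exp_nat_mul _ _).symm
    _ ≤ _ := by gcongr

/-- The constant in the pathwise error bound for the Runge–Kutta scheme. -/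
def pathConst (a b K L ϱ : ℝ) : ℝ :=
  (1 + (b - a) * (L * slopeHolder a b K L ϱ + L * (b - a) + 1)) *
      Real.exp ((b - a) * (L * (1 + (b - a) * L))) + 2 * slopeHolder a b K L ϱ

theorem pathConst_pos (hab : a < b) (hK : 0 < K) (hL : 0 < L) : 0 < pathConst a b K L ϱ := by
  have := slopeHolder_pos (ϱ := ϱ) hab hK hL
  have := sub_pos.2 hab
  unfold pathConst
  positivity

/-- Discrete Gronwall for the error decomposition. Randomness enters only through `T`, and `m * h =
b - a` keeps the constant independent of `m`. -/
theorem norm_sol_sub_rkValue_le (hab : a < b) (hm : 0 < m) (hK : 0 < K) (hL : 0 < L)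
    (hϱ0 : 0 < ϱ) (hϱ1 : ϱ ≤ 1) (hδ0 : 0 ≤ δ) (hδ : δ ≤ 1) (hf : InClass a b d K L ϱ η f)
    (hn : IsNoisy δ η f η' f') (hz : IsSolution η f z) {T : ℝ}
    (hT : ∀ j ≤ m, ‖∑ k ∈ Finset.range j, stepDefect hab.le f z m k (s k)‖ ≤ T)
    {j : ℕ} (hj : j ≤ m) :
    ‖z (mesh hab.le m j) - rkValue hab.le m s η' f' j‖ ≤
      (1 + (b - a) * (L * slopeHolder a b K L ϱ + L * (b - a) + 1)) *
        Real.exp ((b - a) * (L * (1 + (b - a) * L))) * (T + δ + ((b - a) / m) ^ (1 + ϱ)) := by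
  have hl : 0 < b - a := sub_pos.2 hab
  have hm' : (0 : ℝ) < m := Nat.cast_pos.2 hm
  have hh : 0 < (b - a) / m := div_pos hl hm'
  have hC := slopeHolder_pos (ϱ := ϱ) hab hK hL
  have hT0 : 0 ≤ T := (norm_nonneg _).trans (hT 0 (Nat.zero_le _))
  set H := ((b - a) / m) ^ (1 + ϱ) with hH
  have hH0 : 0 < H := Real.rpow_pos_of_pos hh _
  have h := le_mul_exp_of_le_add_sum
    (u := fun j => ‖z (mesh hab.le m j) - rkValue hab.le m s η' f' j‖)
    (D := δ + T) (h := (b - a) / m) (α := L * (1 + (b - a) * L))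
    (β := L * (slopeHolder a b K L ϱ * H + (b - a) * δ) + δ) (by positivity) hh.le
    (by positivity) (by positivity) (m := m) (fun j hj => ?_) hj
  · refine h.trans ?_
    have e1 : (m : ℝ) * ((b - a) / m * (L * (1 + (b - a) * L))) =
        (b - a) * (L * (1 + (b - a) * L)) := by field_simp
    have e2 : (m : ℝ) * ((b - a) / m * (L * (slopeHolder a b K L ϱ * H + (b - a) * δ) + δ)) =
        (b - a) * (L * (slopeHolder a b K L ϱ * H + (b - a) * δ) + δ) := by field_simp
    rw [e1, e2, mul_right_comm]
    gcongr
    set l := b - a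
    set C := slopeHolder a b K L ϱ
    have p1 : 0 ≤ l * (L * C) * (T + δ) := by positivity
    have p2 : 0 ≤ l * (L * l + 1) * (T + H) := by positivity
    nlinarith
  · rw [sol_sub_rkValue hab hz]
    refine (norm_add₃_le).trans ?_
    have h1 : ‖η - η'‖ ≤ δ := by
      rw [norm_sub_rev]
      exact mem_closedBall_iff_norm.1 hn.1
    refine add_le_add (add_le_add h1 (hT j hj)) ((norm_sum_le _ _).trans ?_)
    refine Finset.sum_le_sum fun k hk => ?_
    rw [norm_smul, Real.norm_eq_abs, abs_of_pos hh]
    refine mul_le_mul_of_nonneg_left ?_ hh.le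
    exact norm_noisy_slope_sub_le hab hm hK hL hϱ0 hϱ1 hδ hf hn hz
      (lt_of_lt_of_le (Finset.mem_range.1 hk) hj)

/-- The pathwise error bound for the randomized Runge–Kutta method. -/
theorem norm_sol_sub_rungeKutta_le {Ω : Type*} (τ : ℕ → Ω → unitInterval) (ω : Ω)
    (hab : a < b) (hm : 0 < m) (hK : 0 < K) (hL : 0 < L)
    (hϱ0 : 0 < ϱ) (hϱ1 : ϱ ≤ 1) (hδ0 : 0 ≤ δ) (hδ : δ ≤ 1) (hf : InClass a b d K L ϱ η f)
    (hn : IsNoisy δ η f η' f') (hz : IsSolution η f z) {T : ℝ}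
    (hT : ∀ j ≤ m, ‖∑ k ∈ Finset.range j, stepDefect hab.le f z m k (τ k ω)‖ ≤ T) (t : Icc a b) :
    ‖z t - rungeKutta hab.le m τ η' f' ω t‖ ≤
      pathConst a b K L ϱ * (T + δ + ((b - a) / m) ^ (1 + ϱ)) := by
  have hl : 0 < b - a := sub_pos.2 hab
  have hm' : (0 : ℝ) < m := Nat.cast_pos.2 hm
  have hh : 0 < (b - a) / m := div_pos hl hm'
  have hC := slopeHolder_pos (ϱ := ϱ) hab hK hL
  have hT0 : 0 ≤ T := (norm_nonneg _).trans (hT 0 (Nat.zero_le _))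
  obtain ⟨j, hjdef⟩ : ∃ j, j = min ⌊((t : ℝ) - a) / ((b - a) / m)⌋₊ (m - 1) := ⟨_, rfl⟩
  obtain ⟨hjm, hjt, htj⟩ := mesh_index_spec hab hm t hjdef
  have hrk : rungeKutta hab.le m τ η' f' ω t =
      rkValue hab.le m (fun j => τ j ω) η' f' j +
        (((t : ℝ) - (a + j * ((b - a) / m))) / ((b - a) / m)) •
          (rkValue hab.le m (fun j => τ j ω) η' f' (j + 1) -
            rkValue hab.le m (fun j => τ j ω) η' f' j) := by
    rw [hjdef]; rfl
  rw [hrk]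
  have E0 := norm_sol_sub_rkValue_le hab hm hK hL hϱ0 hϱ1 hδ0 hδ hf hn hz hT hjm.le
  have E1 := norm_sol_sub_rkValue_le hab hm hK hL hϱ0 hϱ1 hδ0 hδ hf hn hz hT
    (Nat.succ_le_of_lt hjm)
  set r := ((t : ℝ) - (a + j * ((b - a) / m))) / ((b - a) / m) with hr
  have hrh : r * ((b - a) / m) = (t : ℝ) - (a + j * ((b - a) / m)) := by
    rw [hr, div_mul_cancel₀ _ hh.ne']
  have hr0 : 0 ≤ r := div_nonneg (by linarith) hh.le
  have hr1 : r ≤ 1 := by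
    rw [hr, div_le_one hh]
    push_cast at htj
    linarith
  have e1 := coe_mesh hab.le hm hjm.le
  have e2 := coe_mesh hab.le hm (Nat.succ_le_of_lt hjm)
  set t₀ := mesh hab.le m j with ht₀
  set t₁ := mesh hab.le m (j + 1) with ht₁
  have k1 : (t : ℝ) - t₀ = r * ((b - a) / m) := by rw [hrh, e1]
  have k2 : (t₁ : ℝ) - t₀ = (b - a) / m := by rw [e1, e2]; push_cast; ring
  have G0 := hz.norm_sub_sub_smul_le hab hK hL hϱ0 hϱ1 hf (s := t₀) (u := t₀) (t := t)
    (h := (b - a) / m) le_rfl (Subtype.coe_le_coe.1 (by rw [e1]; exact hjt)) hh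
    (by rw [k1]; exact mul_le_of_le_one_left hh.le hr1)
  have G1 := hz.norm_sub_sub_smul_le hab hK hL hϱ0 hϱ1 hf (s := t₀) (u := t₀) (t := t₁)
    (h := (b - a) / m) le_rfl (Subtype.coe_le_coe.1 (by linarith)) hh k2.le
  rw [k1] at G0
  rw [k2] at G1
  set V₀ := rkValue hab.le m (fun j => τ j ω) η' f' j
  set V₁ := rkValue hab.le m (fun j => τ j ω) η' f' (j + 1)
  set H := ((b - a) / m) ^ (1 + ϱ) with hH
  have hH0 : 0 < H := Real.rpow_pos_of_pos hh _
  -- A convex combination of the two nodal errors, and two Taylor remainders, which account for `2 *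
  -- slopeHolder` in `pathConst`.
  have e : z t - (V₀ + r • (V₁ - V₀)) = ((1 - r) • (z t₀ - V₀) + r • (z t₁ - V₁)) +
      (z t - z t₀ - (r * ((b - a) / m)) • f (t₀, z t₀)) -
      r • (z t₁ - z t₀ - ((b - a) / m) • f (t₀, z t₀)) := by
    simp only [smul_sub, sub_smul, one_smul, mul_smul]
    abel
  rw [e]
  have n1 : ‖(1 - r) • (z t₀ - V₀) + r • (z t₁ - V₁)‖ ≤
      (1 + (b - a) * (L * slopeHolder a b K L ϱ + L * (b - a) + 1)) *
        Real.exp ((b - a) * (L * (1 + (b - a) * L))) * (T + δ + H) := by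
    refine (norm_add_le _ _).trans ?_
    rw [norm_smul, norm_smul, Real.norm_eq_abs, Real.norm_eq_abs, abs_of_nonneg hr0,
      abs_of_nonneg (sub_nonneg.2 hr1)]
    have q0 := mul_le_mul_of_nonneg_left E0 (sub_nonneg.2 hr1)
    have q1 := mul_le_mul_of_nonneg_left E1 hr0
    linarith
  have n2 : ‖r • (z t₁ - z t₀ - ((b - a) / m) • f (t₀, z t₀))‖ ≤ slopeHolder a b K L ϱ * H := by
    rw [norm_smul, Real.norm_eq_abs, abs_of_nonneg hr0]
    exact (mul_le_of_le_one_left (norm_nonneg _) hr1).trans G1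
  have n3 := norm_sub_le (((1 - r) • (z t₀ - V₀) + r • (z t₁ - V₁)) +
      (z t - z t₀ - (r * ((b - a) / m)) • f (t₀, z t₀)))
      (r • (z t₁ - z t₀ - ((b - a) / m) • f (t₀, z t₀)))
  have n4 := norm_add_le ((1 - r) • (z t₀ - V₀) + r • (z t₁ - V₁))
      (z t - z t₀ - (r * ((b - a) / m)) • f (t₀, z t₀))
  have n5 : 0 ≤ slopeHolder a b K L ϱ * (T + δ) := by positivity
  rw [pathConst, add_mul]
  linarith

end Pathwise

end NoisyODE

end

noncomputable section

namespace NoisyODE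

/-! ### Centring of the step defects and tails of their partial sums -/

section MeanZero

variable {a b : ℝ} {d : ℕ} {K L ϱ : ℝ} {η : E d} {f : RHS a b d} {z : ℝ → E d}

theorem hasDerivWithinAt_coord {z : ℝ → E d} {z' : E d} {s : Set ℝ} {t : ℝ}
    (h : HasDerivWithinAt z z' s t) (c : Fin d) :
    HasDerivWithinAt (fun t => z t c) (z' c) s t :=
  (PiLp.proj (𝕜 := ℝ) 1 (fun _ : Fin d => ℝ) c).hasFDerivAt.comp_hasDerivWithinAt t h

theorem continuous_coord (c : Fin d) : Continuous fun x : E d => x c :=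
  (PiLp.proj (𝕜 := ℝ) 1 (fun _ : Fin d => ℝ) c).continuous

theorem abs_coord_le_norm (x : E d) (c : Fin d) : |x c| ≤ ‖x‖ := by
  rw [PiLp.norm_eq_of_L1]
  exact Finset.single_le_sum (f := fun i => ‖x i‖) (fun i _ => norm_nonneg _) (Finset.mem_univ c)

theorem IsSolution.integral_slope_coord (hz : IsSolution η f z) (hab : a ≤ b)
    (hf : Continuous f) (c : Fin d) (s t : Icc a b) (hst : s ≤ t) :
    ∫ x in (s : ℝ)..t, f (projIcc a b hab x, z (projIcc a b hab x)) c = z t c - z s c := by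
  have hsub : Icc (s : ℝ) t ⊆ Icc a b := Icc_subset_Icc s.2.1 t.2.2
  have hd : ∀ x ∈ Icc (s : ℝ) t, HasDerivWithinAt (fun x => z x c)
      (f (projIcc a b hab x, z (projIcc a b hab x)) c) (Icc (s : ℝ) t) x := by
    intro x hx
    rw [projIcc_of_mem hab (hsub hx)]
    exact hasDerivWithinAt_coord ((hz.2 ⟨x, hsub hx⟩).mono hsub) c
  have hcont : Continuous fun x : ℝ => f (projIcc a b hab x, z (projIcc a b hab x)) c :=
    (continuous_coord c).comp (hf.comp (continuous_projIcc.prodMk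
      (hz.continuous_restrict.comp continuous_projIcc)))
  refine intervalIntegral.integral_eq_sub_of_hasDerivAt_of_le (f := fun x => z x c) hst
    (fun x hx => (hd x hx).continuousWithinAt) (fun x hx => ?_) (hcont.intervalIntegrable _ _)
  exact (hd x (Ioo_subset_Icc_self hx)).hasDerivAt (Icc_mem_nhds hx.1 hx.2)

theorem continuous_randomMesh (hab : a ≤ b) (m j : ℕ) : Continuous (randomMesh hab m j) :=
  continuous_projIcc.comp (by fun_prop)

theorem IsSolution.continuous_stepDefect (hz : IsSolution η f z) (hab : a ≤ b) (hf : Continuous f)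
    (m j : ℕ) : Continuous (stepDefect hab f z m j) := by
  have h : Continuous fun t : Icc a b => f (t, z t) :=
    hf.comp (continuous_id.prodMk hz.continuous_restrict)
  have h' : Continuous fun u => f (randomMesh hab m j u, z (randomMesh hab m j u)) :=
    h.comp (continuous_randomMesh hab m j)
  have h'' : Continuous fun u => ((b - a) / (m : ℝ)) •
      f (randomMesh hab m j u, z (randomMesh hab m j u)) :=
    (continuous_const_smul ((b - a) / (m : ℝ))).comp h'
  exact continuous_const.sub h''

/-- The substitution `x = t_j + h u` turns the mean of `h` times the slope into the integral of `z'`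
over the mesh interval, which is the increment of `z`. -/
theorem IsSolution.integral_stepDefect_coord (hz : IsSolution η f z) (hab : a < b)
    (hf : Continuous f) {m j : ℕ} (hj : j < m) (c : Fin d) :
    ∫ u : unitInterval, stepDefect hab.le f z m j u c = 0 := by
  have hm : 0 < m := by omega
  have hh : 0 < (b - a) / m := div_pos (sub_pos.2 hab) (Nat.cast_pos.2 hm)
  set h := (b - a) / (m : ℝ) with hhdef
  have hg : Continuous fun x : ℝ => f (projIcc a b hab.le x, z (projIcc a b hab.le x)) c :=
    (continuous_coord c).comp (hf.comp (continuous_projIcc.prodMk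
      (hz.continuous_restrict.comp continuous_projIcc)))
  set g : ℝ → ℝ := fun x => f (projIcc a b hab.le x, z (projIcc a b hab.le x)) c with hgdef
  have e1 : (fun u : unitInterval => stepDefect hab.le f z m j u c) = fun u : unitInterval =>
      (fun x : ℝ => (z (mesh hab.le m (j + 1)) c - z (mesh hab.le m j) c) -
        h * g ((a + j * h) + h * x)) u := by
    ext u
    simp only [stepDefect, PiLp.sub_apply, PiLp.smul_apply, smul_eq_mul, hgdef, randomMesh,
      ← hhdef, mul_comm (u : ℝ) h]
  have hi : IntervalIntegrable (fun x : ℝ => h * g ((a + j * h) + h * x)) volume 0 1 :=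
    (continuous_const.mul (hg.comp (by fun_prop :
      Continuous fun x : ℝ => (a + j * h) + h * x))).intervalIntegrable _ _
  rw [e1]
  refine (unitInterval.measurePreserving_coe.integral_comp unitInterval.measurableEmbedding_coe
    fun x : ℝ => (z (mesh hab.le m (j + 1)) c - z (mesh hab.le m j) c) -
        h * g ((a + j * h) + h * x)).trans ?_
  rw [integral_Icc_eq_integral_Ioc, ← intervalIntegral.integral_of_le zero_le_one,
    intervalIntegral.integral_sub (by simp) hi,
    intervalIntegral.integral_const_mul, intervalIntegral.integral_comp_add_mul _ hh.ne']
  have e2 := coe_mesh hab.le hm hj.le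
  have e3 := coe_mesh hab.le hm (Nat.succ_le_of_lt hj)
  have h2 := hz.integral_slope_coord hab.le hf c (mesh hab.le m j) (mesh hab.le m (j + 1))
    (Subtype.coe_le_coe.1 (by rw [e2, e3]; push_cast; linarith))
  have e4 : a + (j : ℝ) * h + h * 0 = mesh hab.le m j := by rw [e2]; ring
  have e5 : a + (j : ℝ) * h + h * 1 = mesh hab.le m (j + 1) := by rw [e3]; push_cast; ring
  rw [e4, e5, h2]
  simp only [intervalIntegral.integral_const, sub_zero, smul_eq_mul]
  field_simp
  ring

end MeanZero

section Tail

variable {a b : ℝ} {d : ℕ} {K L ϱ : ℝ} {η : E d} {f : RHS a b d} {z : ℝ → E d}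
  {Ω : Type*} [MeasurableSpace Ω] {P : Measure Ω} [IsProbabilityMeasure P]
  {τ : ℕ → Ω → unitInterval}

/-- An `ℓ¹` norm of at least `d * x` forces some coordinate to be at least `x` in modulus; the
scalar maximal inequality and a union bound over coordinates finish. -/
theorem measure_exists_norm_sum_stepDefect_ge_le (hd : 0 < d) (hab : a < b) (hK : 0 < K)
    (hL : 0 < L) (hϱ0 : 0 < ϱ) (hϱ1 : ϱ ≤ 1) (hf : InClass a b d K L ϱ η f)
    (hz : IsSolution η f z) (hτ : ∀ j, Measurable (τ j)) (hind : iIndepFun τ P)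
    (hunif : ∀ j, P.map (τ j) = volume) {m : ℕ} (hm : 0 < m) {x : ℝ} (hx : 0 ≤ x) :
    P {ω | ∃ j ≤ m, d * x ≤ ‖∑ k ∈ Finset.range j, stepDefect hab.le f z m k (τ k ω)‖} ≤
      d * (2 * ENNReal.ofReal (Real.exp (-(x ^ 2 /
        (2 * (m * (slopeHolder a b K L ϱ * ((b - a) / m) ^ (1 + ϱ)) ^ 2)))))) := by
  set σ := slopeHolder a b K L ϱ * ((b - a) / m) ^ (1 + ϱ) with hσdef
  have hh : 0 < (b - a) / m := div_pos (sub_pos.2 hab) (Nat.cast_pos.2 hm)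
  have hσ : 0 < σ := mul_pos (slopeHolder_pos hab hK hL) (Real.rpow_pos_of_pos hh _)
  -- The scalar inequality wants an infinite centred sequence. Only the indices `k < m` are genuine
  -- steps, so the rest is replaced by zero.
  set Y : Fin d → ℕ → unitInterval → ℝ := fun c k u =>
    if k < m then stepDefect hab.le f z m k u c else 0 with hY
  have hYm : ∀ c k, Measurable (Y c k) := fun c k => by
    by_cases hk : k < m
    · simp only [hY, hk, if_true]
      exact ((continuous_coord c).comp (hz.continuous_stepDefect hab.le hf.cont m k)).measurable
    · simp only [hY, hk, if_false]
      exact measurable_const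
  have hYb : ∀ c k u, |Y c k u| ≤ σ := fun c k u => by
    by_cases hk : k < m
    · simp only [hY, hk, if_true]
      exact (abs_coord_le_norm _ c).trans
        (norm_stepDefect_le hab hm hK hL hϱ0 hϱ1 hf hz hk u)
    · simp [hY, hk, hσ.le]
  have hYi : ∀ c k, ∫ ω, Y c k (τ k ω) ∂P = 0 := fun c k => by
    rw [← integral_map (hτ k).aemeasurable (hYm c k).aestronglyMeasurable, hunif k]
    by_cases hk : k < m
    · simp only [hY, hk, if_true]
      exact hz.integral_stepDefect_coord hab hf.cont hk c
    · simp [hY, hk]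
  have htail : ∀ c, P {ω | ∃ j ≤ m, x ≤ |∑ k ∈ Finset.range j, Y c k (τ k ω)|} ≤
      2 * ENNReal.ofReal (Real.exp (-(x ^ 2 / (2 * (m * σ ^ 2))))) := fun c =>
    measure_exists_abs_partialSum_ge_le (fun k => (hYm c k).comp (hτ k))
      (hind.comp (Y c) (hYm c)) hσ (fun k ω => hYb c k _) (hYi c) hm hx
  have hsub : {ω | ∃ j ≤ m, d * x ≤ ‖∑ k ∈ Finset.range j, stepDefect hab.le f z m k (τ k ω)‖} ⊆
      ⋃ c, {ω | ∃ j ≤ m, x ≤ |∑ k ∈ Finset.range j, Y c k (τ k ω)|} := by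
    rintro ω ⟨j, hj, hω⟩
    rw [PiLp.norm_eq_of_L1] at hω
    have : Nonempty (Fin d) := ⟨⟨0, hd⟩⟩
    obtain ⟨c, -, hc⟩ := Finset.exists_le_of_sum_le (s := Finset.univ) (f := fun _ : Fin d => x)
      (g := fun c => ‖(∑ k ∈ Finset.range j, stepDefect hab.le f z m k (τ k ω)) c‖)
      Finset.univ_nonempty (by simpa using hω)
    refine mem_iUnion.2 ⟨c, j, hj, hc.trans (le_of_eq ?_)⟩
    rw [Real.norm_eq_abs]
    congr 1
    have := map_sum (PiLp.proj (𝕜 := ℝ) 1 (fun _ : Fin d => ℝ) c)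
      (fun k => stepDefect hab.le f z m k (τ k ω)) (Finset.range j)
    refine Eq.trans this (Finset.sum_congr rfl fun k hk => ?_)
    have hk' : k < m := lt_of_lt_of_le (Finset.mem_range.1 hk) hj
    simp [hY, hk']
  refine (measure_mono hsub).trans ((measure_iUnion_fintype_le _ _).trans ?_)
  refine (Finset.sum_le_sum fun c _ => htail c).trans ?_
  simp

end Tail

/-! ### From Gaussian tails to the worst-case error of the scheme -/

section Moment

theorem summable_rpow_mul_exp_neg_sq (p : ℝ) :
    Summable fun k : ℕ => ((k : ℝ) + 2) ^ p * Real.exp (-((k : ℝ) ^ 2 / 2)) := by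
  have h1 := (summable_nat_add_iff 2).2
    (Real.summable_pow_mul_exp_neg_nat_mul ⌈p⌉₊ (r := 1) one_pos)
  -- The factor `exp 3` comes from `-k ^ 2 / 2 ≤ 3 - (k + 2)`.
  refine Summable.of_nonneg_of_le (fun k => by positivity) (fun k => ?_)
    (h1.mul_left (Real.exp 3))
  have h2 : ((k : ℝ) + 2) ^ p ≤ ((k : ℝ) + 2) ^ ⌈p⌉₊ := by
    rw [← Real.rpow_natCast]
    exact Real.rpow_le_rpow_of_exponent_le (by linarith [(Nat.cast_nonneg k : (0 : ℝ) ≤ k)])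
      (Nat.le_ceil p)
  push_cast
  rw [mul_left_comm, ← Real.exp_add]
  refine mul_le_mul h2 (Real.exp_le_exp.2 ?_) (Real.exp_pos _).le (by positivity)
  nlinarith [sq_nonneg ((k : ℝ) - 1)]

variable {Ω : Type*} [MeasurableSpace Ω] {P : Measure Ω}

/-- Slicing at multiples of `s`: where `k s ≤ T < (k + 1) s`, the variable `X` is at most `A s (k +
2)`. -/
theorem lintegral_rpow_le_tsum_measure {X : Ω → ℝ≥0∞} {T : Ω → ℝ} {A s p : ℝ} (hA : 0 ≤ A)
    (hs : 0 < s) (hp : 0 ≤ p) (hT : ∀ ω, 0 ≤ T ω)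
    (hX : ∀ ω, X ω ≤ ENNReal.ofReal (A * (s + T ω))) :
    ∫⁻ ω, X ω ^ p ∂P ≤
      ∑' k : ℕ, ENNReal.ofReal ((A * s * (k + 2)) ^ p) * P {ω | k * s ≤ T ω} := by
  -- Neither `X` nor `T` is assumed measurable. Measurable hulls have the same measure and allow sum
  -- and integral to be interchanged.
  set B : ℕ → Set Ω := fun k => toMeasurable P {ω | k * s ≤ T ω} with hB
  have hle : ∀ ω, X ω ^ p ≤ ∑' k : ℕ, (B k).indicator
      (fun _ => ENNReal.ofReal ((A * s * (k + 2)) ^ p)) ω := by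
    intro ω
    set k := ⌊T ω / s⌋₊ with hk
    have h1 : (k : ℝ) * s ≤ T ω :=
      (le_div_iff₀ hs).1 (Nat.floor_le (div_nonneg (hT ω) hs.le))
    have h2 : T ω < (k + 1) * s := (div_lt_iff₀ hs).1 (Nat.lt_floor_add_one _)
    refine le_trans ?_ (ENNReal.le_tsum k)
    rw [indicator_of_mem (subset_toMeasurable P _ h1),
      ← ENNReal.ofReal_rpow_of_nonneg (by positivity) hp]
    refine ENNReal.rpow_le_rpow ((hX ω).trans (ENNReal.ofReal_le_ofReal ?_)) hp
    rw [mul_assoc]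
    refine mul_le_mul_of_nonneg_left ?_ hA
    linarith
  refine (lintegral_mono hle).trans ?_
  rw [lintegral_tsum fun k =>
    (measurable_const.indicator (measurableSet_toMeasurable P _)).aemeasurable]
  refine ENNReal.tsum_le_tsum fun k => ?_
  rw [lintegral_indicator_const (measurableSet_toMeasurable P _), measure_toMeasurable]

/-- The constant in the moment bound obtained from Gaussian tails. -/
def tailConst (d : ℕ) (p : ℝ) : ℝ :=
  ∑' k : ℕ, 2 * d * (((k : ℝ) + 2) ^ p * Real.exp (-((k : ℝ) ^ 2 / 2)))

theorem tailConst_nonneg (d : ℕ) (p : ℝ) : 0 ≤ tailConst d p :=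
  tsum_nonneg fun k => by positivity

theorem lintegral_rpow_le_of_subgaussian_tail {X : Ω → ℝ≥0∞} {T : Ω → ℝ} {A s p : ℝ} {d : ℕ}
    (hA : 0 ≤ A) (hs : 0 < s) (hp : 0 ≤ p) (hT : ∀ ω, 0 ≤ T ω)
    (hX : ∀ ω, X ω ≤ ENNReal.ofReal (A * (s + T ω)))
    (htail : ∀ k : ℕ, P {ω | k * s ≤ T ω} ≤
      ENNReal.ofReal (2 * d * Real.exp (-((k : ℝ) ^ 2 / 2)))) :
    ∫⁻ ω, X ω ^ p ∂P ≤ ENNReal.ofReal ((A * s) ^ p * tailConst d p) := by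
  refine (lintegral_rpow_le_tsum_measure hA hs hp hT hX).trans ?_
  rw [tailConst, ← tsum_mul_left, ENNReal.ofReal_tsum_of_nonneg (fun k => by positivity)
    (((summable_rpow_mul_exp_neg_sq p).mul_left (2 * (d : ℝ))).mul_left _)]
  refine ENNReal.tsum_le_tsum fun k => ?_
  refine (mul_le_mul_right (htail k) _).trans (le_of_eq ?_)
  rw [← ENNReal.ofReal_mul (by positivity), Real.mul_rpow (by positivity) (by positivity)]
  congr 1
  ring

end Moment

section Upper

variable {a b : ℝ} {d : ℕ} {K L ϱ δ : ℝ} {η η' : E d} {f f' : RHS a b d}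
  {Ω : Type*} [MeasurableSpace Ω] {P : Measure Ω} [IsProbabilityMeasure P]
  {τ : ℕ → Ω → unitInterval}

theorem lpError_rungeKutta_le (hd : 0 < d) (hab : a < b) (hK : 0 < K)
    (hL : 0 < L) (hϱ0 : 0 < ϱ) (hϱ1 : ϱ ≤ 1) {p : ℝ} (hp : 0 < p) (hδ0 : 0 ≤ δ) (hδ : δ ≤ 1)
    (hf : InClass a b d K L ϱ η f) (hn : IsNoisy δ η f η' f')
    (hτ : ∀ j, Measurable (τ j)) (hind : iIndepFun τ P)
    (hunif : ∀ j, P.map (τ j) = volume) {m : ℕ} (hm : 0 < m) :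
    lpError P p (rungeKutta hab.le m τ) η f η' f' ≤
      ENNReal.ofReal (pathConst a b K L ϱ * d * (tailConst d p) ^ (1 / p) *
        (δ + (1 + slopeHolder a b K L ϱ) * (√m * ((b - a) / m) ^ (1 + ϱ)))) := by
  have hz := isSolution_sol hab hK hL hf
  set z := sol η f with hzdef
  have hh : 0 < (b - a) / m := div_pos (sub_pos.2 hab) (Nat.cast_pos.2 hm)
  have hC := slopeHolder_pos (ϱ := ϱ) hab hK hL
  have hA := pathConst_pos (ϱ := ϱ) hab hK hL
  set C := slopeHolder a b K L ϱ with hCdef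
  set A := pathConst a b K L ϱ with hAdef
  set H := ((b - a) / m) ^ (1 + ϱ) with hH
  have hH0 : 0 < H := Real.rpow_pos_of_pos hh _
  have hm1 : (1 : ℝ) ≤ m := by exact_mod_cast hm
  have hsm : 1 ≤ √(m : ℝ) := Real.one_le_sqrt.2 hm1
  have hd1 : (1 : ℝ) ≤ d := by exact_mod_cast hd
  -- One scale with two roles: it dominates the deterministic part `δ + H`, and it dominates the
  -- Hoeffding deviation `C * √m * H`, so that level `k * (d * s)` is exceeded with probability at
  -- most `2 d exp (-k ^ 2 / 2)`.
  set s := δ + (1 + C) * (√m * H) with hs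
  have hs0 : 0 < s := by positivity
  set T : Ω → ℝ := fun ω => (Finset.range (m + 1)).sup' Finset.nonempty_range_add_one
    fun j => ‖∑ k ∈ Finset.range j, stepDefect hab.le f z m k (τ k ω)‖ with hTdef
  have hT : ∀ ω, ∀ j ≤ m, ‖∑ k ∈ Finset.range j, stepDefect hab.le f z m k (τ k ω)‖ ≤ T ω :=
    fun ω j hj => Finset.le_sup' (fun j => ‖∑ k ∈ Finset.range j,
      stepDefect hab.le f z m k (τ k ω)‖) (Finset.mem_range.2 (by omega))
  have hT0 : ∀ ω, 0 ≤ T ω := fun ω => (norm_nonneg _).trans (hT ω 0 (Nat.zero_le _))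
  have key := lintegral_rpow_le_of_subgaussian_tail (P := P) (p := p) (d := d) (T := T) (A := A)
    (s := d * s) (X := fun ω => ⨆ t : Icc a b, ‖z t - rungeKutta hab.le m τ η' f' ω t‖ₑ)
    hA.le (by positivity) hp.le hT0 (fun ω => iSup_le fun t => ?_) (fun k => ?_)
  · rw [lpError]
    refine (ENNReal.rpow_le_rpow key (by positivity)).trans (le_of_eq ?_)
    rw [ENNReal.ofReal_rpow_of_nonneg
      (mul_nonneg (by positivity) (tailConst_nonneg d p)) (by positivity),
      Real.mul_rpow (by positivity) (tailConst_nonneg d p), ← Real.rpow_mul (by positivity),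
      mul_one_div_cancel hp.ne', Real.rpow_one]
    congr 1
    ring
  · rw [← ofReal_norm]
    refine ENNReal.ofReal_le_ofReal ?_
    refine (norm_sol_sub_rungeKutta_le τ ω hab hm hK hL hϱ0 hϱ1 hδ0 hδ hf hn hz (hT ω) t).trans ?_
    refine mul_le_mul_of_nonneg_left ?_ hA.le
    have h1 : H ≤ √m * H := le_mul_of_one_le_left hH0.le hsm
    have h2 : δ + H ≤ s := by
      have : 0 ≤ C * (√m * H) := by positivity
      rw [hs]; linarith
    have h3 : s ≤ d * s := le_mul_of_one_le_left hs0.le hd1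
    rw [← hH]
    linarith
  · have h1 := measure_exists_norm_sum_stepDefect_ge_le hd hab hK hL hϱ0 hϱ1 hf hz hτ hind hunif hm
      (x := k * s) (by positivity)
    have h2 : {ω | k * (d * s) ≤ T ω} ⊆ {ω | ∃ j ≤ m, d * (k * s) ≤
        ‖∑ k ∈ Finset.range j, stepDefect hab.le f z m k (τ k ω)‖} := by
      intro ω hω
      obtain ⟨j, hj, hj'⟩ := (Finset.le_sup'_iff _).1 (show (k : ℝ) * (d * s) ≤ T ω from hω)
      exact ⟨j, by simpa [Nat.lt_succ_iff] using hj, by rwa [mul_left_comm]⟩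
    refine (measure_mono h2).trans (h1.trans ?_)
    rw [← hCdef, ← hH, ENNReal.ofReal_mul (by positivity), ENNReal.ofReal_mul (by positivity),
      ENNReal.ofReal_natCast, ENNReal.ofReal_ofNat, ← mul_assoc, mul_comm (d : ℝ≥0∞) 2]
    refine mul_le_mul_right (ENNReal.ofReal_le_ofReal (Real.exp_le_exp.2 (neg_le_neg ?_))) _
    have h3 : (m : ℝ) * (C * H) ^ 2 ≤ s ^ 2 := by
      have e : (m : ℝ) * (C * H) ^ 2 = (C * (√m * H)) ^ 2 := by
        have := Real.sq_sqrt (Nat.cast_nonneg (α := ℝ) m)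
        calc (m : ℝ) * (C * H) ^ 2 = √m ^ 2 * (C * H) ^ 2 := by rw [this]
          _ = _ := by ring
      rw [e]
      have : 0 ≤ √m * H := by positivity
      refine pow_le_pow_left₀ (by positivity) ?_ 2
      rw [hs]; linarith
    rw [div_le_div_iff₀ two_pos (by positivity), mul_pow]
    nlinarith [mul_le_mul_of_nonneg_left h3 (sq_nonneg (k : ℝ))]

/-- The constant in the error bound of the randomized Runge–Kutta method. -/
def upperConst (a b : ℝ) (d : ℕ) (K L ϱ p : ℝ) : ℝ :=
  pathConst a b K L ϱ * d * (tailConst d p) ^ (1 / p) *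
    (1 + (1 + slopeHolder a b K L ϱ) * ((b - a) ^ (1 + ϱ) * 3 ^ (ϱ + 1 / 2))) + 1

/-- The final summand `1` in `upperConst` is there for strict positivity, `tailConst` being shown
only nonnegative. -/
theorem upperConst_pos (hab : a < b) (hK : 0 < K) (hL : 0 < L) (p : ℝ) :
    0 < upperConst a b d K L ϱ p := by
  have := pathConst_pos (ϱ := ϱ) hab hK hL
  have := slopeHolder_pos (ϱ := ϱ) hab hK hL
  have := tailConst_nonneg d p
  have := sub_pos.2 hab
  unfold upperConst
  positivity

theorem worstError_rungeKutta_le (hd : 0 < d) (hab : a < b) (hK : 0 < K)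
    (hL : 0 < L) (hϱ0 : 0 < ϱ) (hϱ1 : ϱ ≤ 1) {p : ℝ} (hp : 0 < p) (hδ0 : 0 ≤ δ) (hδ : δ ≤ 1)
    (hτ : ∀ j, Measurable (τ j)) (hind : iIndepFun τ P)
    (hunif : ∀ j, P.map (τ j) = volume) {n : ℕ} (hn : 2 ≤ n) :
    worstError P K L ϱ p δ (rungeKutta (d := d) hab.le (n / 2) τ) ≤
      ENNReal.ofReal (upperConst a b d K L ϱ p * max ((n : ℝ) ^ (-(ϱ + 1 / 2))) δ) := by
  refine iSup_le fun η => iSup_le fun f => iSup_le fun hf => iSup_le fun η' => iSup_le fun f' =>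
    iSup_le fun hnoise => ?_
  have hm : 0 < n / 2 := by omega
  refine (lpError_rungeKutta_le hd hab hK hL hϱ0 hϱ1 hp hδ0 hδ hf hnoise hτ hind hunif hm).trans
    (ENNReal.ofReal_le_ofReal ?_)
  have hC := slopeHolder_pos (ϱ := ϱ) hab hK hL
  have hA := pathConst_pos (ϱ := ϱ) hab hK hL
  have hQ := tailConst_nonneg d p
  have hl : 0 < b - a := sub_pos.2 hab
  have hn0 : (0 : ℝ) < n := Nat.cast_pos.2 (by omega)
  have hm0 : (0 : ℝ) < (n / 2 : ℕ) := Nat.cast_pos.2 hm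
  -- Rounding loss for `n ≥ 2`, the source of `3 ^ (ϱ + 1 / 2)` in `upperConst`.
  have hmn : (n : ℝ) / 3 ≤ (n / 2 : ℕ) := by
    have : n ≤ 3 * (n / 2) := by omega
    have : (n : ℝ) ≤ 3 * (n / 2 : ℕ) := by exact_mod_cast this
    linarith
  set M := max ((n : ℝ) ^ (-(ϱ + 1 / 2))) δ with hM
  have h1 : √((n / 2 : ℕ) : ℝ) * ((b - a) / (n / 2 : ℕ)) ^ (1 + ϱ) ≤
      (b - a) ^ (1 + ϱ) * 3 ^ (ϱ + 1 / 2) * M := by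
    have e1 : √((n / 2 : ℕ) : ℝ) * ((b - a) / (n / 2 : ℕ)) ^ (1 + ϱ) =
        (b - a) ^ (1 + ϱ) * ((n / 2 : ℕ) : ℝ) ^ (-(ϱ + 1 / 2)) := by
      rw [Real.sqrt_eq_rpow, Real.div_rpow hl.le hm0.le, div_eq_mul_inv ((b - a) ^ (1 + ϱ)),
        ← Real.rpow_neg hm0.le,
        mul_left_comm, ← Real.rpow_add hm0]
      congr 2
      ring
    rw [e1, mul_assoc]
    refine mul_le_mul_of_nonneg_left ?_ (Real.rpow_pos_of_pos hl _).le
    calc ((n / 2 : ℕ) : ℝ) ^ (-(ϱ + 1 / 2)) ≤ ((n : ℝ) / 3) ^ (-(ϱ + 1 / 2)) :=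
          Real.rpow_le_rpow_of_nonpos (by positivity) hmn (by linarith)
      _ = 3 ^ (ϱ + 1 / 2) * (n : ℝ) ^ (-(ϱ + 1 / 2)) := by
          rw [Real.div_rpow hn0.le (by norm_num), Real.rpow_neg (by norm_num : (0 : ℝ) ≤ 3),
            div_inv_eq_mul, mul_comm]
      _ ≤ _ := mul_le_mul_of_nonneg_left (le_max_left _ _) (by positivity)
  have h2 : δ ≤ M := le_max_right _ _
  have h3 : 0 ≤ M := hδ0.trans h2
  have h4 := mul_le_mul_of_nonneg_left h1 (by linarith : 0 ≤ 1 + slopeHolder a b K L ϱ)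
  have h5 : 0 ≤ pathConst a b K L ϱ * d * (tailConst d p) ^ (1 / p) := by positivity
  have h6 := mul_le_mul_of_nonneg_left (add_le_add h2 h4) h5
  refine h6.trans ?_
  rw [upperConst, add_mul _ 1 M, one_mul]
  have e : ∀ Z W : ℝ, Z * (M + (1 + slopeHolder a b K L ϱ) * (W * M)) =
      Z * (1 + (1 + slopeHolder a b K L ϱ) * W) * M := fun Z W => by ring
  rw [e]
  linarith

end Upper

end NoisyODE

end

noncomputable section

namespace NoisyODE

/-! ### The Runge–Kutta method as an algorithm of the admitted form -/

section RungeKuttaAlgorithm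

variable {a b : ℝ} {d : ℕ} {Ω : Type*} [MeasurableSpace Ω] {m : ℕ} {τ : ℕ → Ω → unitInterval}

theorem IsCadlag.of_continuous {g : Icc a b → E d} (hg : Continuous g) : IsCadlag g :=
  fun t => ⟨hg.continuousWithinAt, g t, (hg.tendsto t).mono_left nhdsWithin_le_nhds⟩

theorem Algorithm.values_succ (A : Algorithm a b d Ω) (η' : E d) (f' : RHS a b d) (ω : Ω)
    (k : ℕ) (hk : k + 1 ≤ A.i) :
    A.values η' f' ω (k + 1) hk =
      (Fin.snoc (α := fun _ => E d) (A.values η' f' ω k (Nat.le_of_succ_le hk)).1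
        (f' (A.t ⟨k, hk⟩, A.ψ ⟨k, hk⟩ (fun j => A.θ j ω, η',
          (A.values η' f' ω k (Nat.le_of_succ_le hk)).1,
          (A.values η' f' ω k (Nat.le_of_succ_le hk)).2))),
      Fin.snoc (α := fun _ => E d) (A.values η' f' ω k (Nat.le_of_succ_le hk)).2
        (f' (A.θ ⟨k, hk⟩ ω, A.χ ⟨k, hk⟩ (fun j => A.θ j ω, η',
          Fin.snoc (α := fun _ => E d) (A.values η' f' ω k (Nat.le_of_succ_le hk)).1
            (f' (A.t ⟨k, hk⟩, A.ψ ⟨k, hk⟩ (fun j => A.θ j ω, η',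
              (A.values η' f' ω k (Nat.le_of_succ_le hk)).1,
              (A.values η' f' ω k (Nat.le_of_succ_le hk)).2))),
          (A.values η' f' ω k (Nat.le_of_succ_le hk)).2)))) := rfl

/-- The randomized two-stage Runge–Kutta method as an algorithm. -/
def rkAlgorithm (hab : a ≤ b) (d m : ℕ) (hτ : ∀ j, Measurable (τ j)) : Algorithm a b d Ω where
  i := m
  t j := mesh hab m j
  θ j ω := randomMesh hab m j (τ j ω)
  measurable_θ j := (continuous_randomMesh hab m j).measurable.comp (hτ j)
  -- The current value is recovered as `η'` plus `h` times the sum of the second-stage evaluations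
  -- so far.
  ψ _ v := v.2.1 + ∑ k, ((b - a) / m : ℝ) • v.2.2.2 k
  measurable_ψ j := by fun_prop
  -- The step length `h τ_j` of the predictor is read off as `θ_j - t_j`.
  χ j v := (v.2.1 + ∑ k, ((b - a) / m : ℝ) • v.2.2.2 k) +
    ((v.1 j : ℝ) - mesh hab m j) • v.2.2.1 (Fin.last j)
  measurable_χ j := by fun_prop
  -- Each increment is weighted by the fraction of its mesh interval to the left of `t`: a form of
  -- linear interpolation without case distinction, hence visibly continuous.
  φ v t := v.2.1 + ∑ k : Fin m,
    (max 0 (min ((t : ℝ) - (a + (k : ℕ) * ((b - a) / m))) ((b - a) / m)) / ((b - a) / m)) •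
      (((b - a) / m : ℝ) • v.2.2.2 k)
  cadlag_φ v := IsCadlag.of_continuous (by fun_prop)
  measurable_φ s := by fun_prop

theorem rkValue_eq_add_sum (hab : a ≤ b) (s : ℕ → unitInterval) (η' : E d) (f' : RHS a b d)
    (j : ℕ) :
    rkValue hab m s η' f' j = η' + ∑ k : Fin j,
      ((b - a) / m : ℝ) • f' (randomMesh hab m k (s k), rkStage hab m s η' f' k) := by
  induction j with
  | zero => simp [rkValue]
  | succ j ih =>
    rw [Fin.sum_univ_castSucc, ← add_assoc, rkValue_succ, ih]
    rfl

theorem rkAlgorithm_values (hab : a ≤ b) (hτ : ∀ j, Measurable (τ j)) (η' : E d) (f' : RHS a b d)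
    (ω : Ω) (k : ℕ) (hk : k ≤ (rkAlgorithm hab d m hτ).i) :
    (rkAlgorithm hab d m hτ).values η' f' ω k hk =
      (fun j : Fin k => f' (mesh hab m j, rkValue hab m (fun i => τ i ω) η' f' j),
        fun j : Fin k => f' (randomMesh hab m j (τ j ω),
          rkStage hab m (fun i => τ i ω) η' f' j)) := by
  induction k with
  | zero => exact Prod.ext (Subsingleton.elim _ _) (Subsingleton.elim _ _)
  | succ k ih =>
    have hkm : k < m := hk
    have hV := rkValue_eq_add_sum (m := m) hab (fun i => τ i ω) η' f' k
    rw [Algorithm.values_succ, ih (Nat.le_of_succ_le hk)]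
    have hu : (Fin.snoc (α := fun _ => E d)
        (fun j : Fin k => f' (mesh hab m j, rkValue hab m (fun i => τ i ω) η' f' j))
        (f' (mesh hab m k, rkValue hab m (fun i => τ i ω) η' f' k))) =
        fun j : Fin (k + 1) => f' (mesh hab m j, rkValue hab m (fun i => τ i ω) η' f' j) := by
      funext j
      refine Fin.lastCases ?_ (fun j => ?_) j
      · rw [Fin.snoc_last]; rfl
      · rw [Fin.snoc_castSucc]; rfl
    have hw : (Fin.snoc (α := fun _ => E d)
        (fun j : Fin k => f' (randomMesh hab m j (τ j ω),
          rkStage hab m (fun i => τ i ω) η' f' j))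
        (f' (randomMesh hab m k (τ k ω), rkStage hab m (fun i => τ i ω) η' f' k))) =
        fun j : Fin (k + 1) => f' (randomMesh hab m j (τ j ω),
          rkStage hab m (fun i => τ i ω) η' f' j) := by
      funext j
      refine Fin.lastCases ?_ (fun j => ?_) j
      · rw [Fin.snoc_last]; rfl
      · rw [Fin.snoc_castSucc]; rfl
    have hψ : (rkAlgorithm hab d m hτ).ψ ⟨k, hk⟩ (fun j => (rkAlgorithm hab d m hτ).θ j ω, η',
        (fun j : Fin k => f' (mesh hab m j, rkValue hab m (fun i => τ i ω) η' f' j)),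
        fun j : Fin k => f' (randomMesh hab m j (τ j ω),
          rkStage hab m (fun i => τ i ω) η' f' j)) =
        rkValue hab m (fun i => τ i ω) η' f' k := hV.symm
    have hχ : (rkAlgorithm hab d m hτ).χ ⟨k, hk⟩ (fun j => (rkAlgorithm hab d m hτ).θ j ω, η',
        (fun j : Fin (k + 1) => f' (mesh hab m j, rkValue hab m (fun i => τ i ω) η' f' j)),
        fun j : Fin k => f' (randomMesh hab m j (τ j ω),
          rkStage hab m (fun i => τ i ω) η' f' j)) =
        rkStage hab m (fun i => τ i ω) η' f' k := by
      have e : ((randomMesh hab m k (τ k ω) : Icc a b) : ℝ) - mesh hab m k =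
          (b - a) / m * (τ k ω : ℝ) := by
        rw [coe_randomMesh hab hkm, coe_mesh hab (by omega) hkm.le]
        ring
      rw [rkStage, ← e]
      conv_rhs => rw [hV]
      simp only [rkAlgorithm, Fin.val_last]
      rw [← hV]
    refine Prod.ext ?_ ?_
    · simp only
      rw [hψ]
      exact hu
    · simp only
      rw [hψ, show (rkAlgorithm hab d m hτ).t ⟨k, hk⟩ = mesh hab m k from rfl, hu, hχ]
      exact hw

/-- If `t` lies in the `j`-th mesh interval, the clamped weights are 1 before `j` and 0 after it,
and the `j`-th is the interpolation weight. -/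
theorem rungeKutta_eq_output (hab : a < b) (hm : 0 < m) (hτ : ∀ j, Measurable (τ j)) :
    rungeKutta hab.le m τ = (rkAlgorithm hab.le d m hτ).output := by
  funext η' f' ω t
  have hh : 0 < (b - a) / m := div_pos (sub_pos.2 hab) (Nat.cast_pos.2 hm)
  obtain ⟨j, hjdef⟩ : ∃ j, j = min ⌊((t : ℝ) - a) / ((b - a) / m)⌋₊ (m - 1) := ⟨_, rfl⟩
  obtain ⟨hjm, hjt, htj⟩ := mesh_index_spec hab hm t hjdef
  set V := rkValue hab.le m (fun j => τ j ω) η' f' with hV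
  have hrk : rungeKutta hab.le m τ η' f' ω t =
      V j + (((t : ℝ) - (a + j * ((b - a) / m))) / ((b - a) / m)) • (V (j + 1) - V j) := by
    rw [hjdef]; rfl
  have hout : (rkAlgorithm hab.le d m hτ).output η' f' ω t = η' + ∑ k ∈ Finset.range m,
      (max 0 (min ((t : ℝ) - (a + k * ((b - a) / m))) ((b - a) / m)) / ((b - a) / m)) •
        (V (k + 1) - V k) := by
    rw [Finset.sum_range, Algorithm.output]
    have := rkAlgorithm_values hab.le hτ η' f' ω m le_rfl
    change (rkAlgorithm hab.le d m hτ).φ (_, η', ((rkAlgorithm hab.le d m hτ).values η' f' ω m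
      le_rfl).1, ((rkAlgorithm hab.le d m hτ).values η' f' ω m le_rfl).2) t = _
    rw [this]
    simp only [rkAlgorithm, hV, rkValue_succ, add_sub_cancel_left]
  have hle : ∀ k : ℕ, k ≤ j → V k = η' + ∑ i ∈ Finset.range k, (V (i + 1) - V i) := by
    intro k _
    rw [Finset.sum_range_sub]
    simp [hV, rkValue]
  rw [hrk, hout, ← Finset.sum_range_add_sum_Ico _ (Nat.succ_le_of_lt hjm),
    Finset.sum_range_succ, hle j le_rfl, ← add_assoc, ← add_assoc]
  have s1 : ∑ k ∈ Finset.range j, (max 0 (min ((t : ℝ) - (a + k * ((b - a) / m))) ((b - a) / m)) /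
      ((b - a) / m)) • (V (k + 1) - V k) = ∑ k ∈ Finset.range j, (V (k + 1) - V k) := by
    refine Finset.sum_congr rfl fun k hk => ?_
    have hkj : (k : ℝ) + 1 ≤ j := by exact_mod_cast Finset.mem_range.1 hk
    have h1 : ((k : ℝ) + 1) * ((b - a) / m) ≤ j * ((b - a) / m) :=
      mul_le_mul_of_nonneg_right hkj hh.le
    rw [min_eq_right (by linarith), max_eq_right hh.le, div_self hh.ne', one_smul]
  have s2 : ∑ k ∈ Finset.Ico (j + 1) m,
      (max 0 (min ((t : ℝ) - (a + k * ((b - a) / m))) ((b - a) / m)) /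
      ((b - a) / m)) • (V (k + 1) - V k) = 0 := by
    refine Finset.sum_eq_zero fun k hk => ?_
    have hkj : ((j + 1 : ℕ) : ℝ) ≤ k := by exact_mod_cast (Finset.mem_Ico.1 hk).1
    have h1 : ((j + 1 : ℕ) : ℝ) * ((b - a) / m) ≤ k * ((b - a) / m) :=
      mul_le_mul_of_nonneg_right hkj hh.le
    rw [max_eq_left ((min_le_left _ _).trans (by linarith)), zero_div, zero_smul]
  push_cast at htj
  rw [s1, s2, add_zero, min_eq_left (by linarith), max_eq_right (by linarith)]

theorem rungeKutta_mem_Phi (hab : a < b) (hτ : ∀ j, Measurable (τ j)) {n : ℕ} (hn : 2 ≤ n) :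
    rungeKutta hab.le (n / 2) τ ∈ Phi a b d Ω n :=
  ⟨rkAlgorithm hab.le d (n / 2) hτ, Nat.mul_div_le n 2,
    rungeKutta_eq_output hab (by omega) hτ⟩

end RungeKuttaAlgorithm

end NoisyODE

end

noncomputable section

namespace NoisyODE

/-! ### Lower bounds: measurability, locality, reduction to one coordinate -/

section AlgorithmBasic

variable {a b : ℝ} {d : ℕ} {Ω : Type*} [MeasurableSpace Ω]

theorem measurable_snoc {Ω : Type*} [MeasurableSpace Ω] {k : ℕ} {u : Ω → Fin k → E d}
    {v : Ω → E d} (hu : Measurable u) (hv : Measurable v) :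
    Measurable fun ω => Fin.snoc (α := fun _ => E d) (u ω) (v ω) := by
  refine measurable_pi_iff.2 fun j => ?_
  refine Fin.lastCases ?_ (fun j => ?_) j
  · simpa only [Fin.snoc_last] using hv
  · simpa only [Fin.snoc_castSucc] using (measurable_pi_iff.1 hu j)

namespace Algorithm

theorem measurable_values (A : Algorithm a b d Ω) (η' : E d) {f' : RHS a b d}
    (hf' : Measurable f') (k : ℕ) (hk : k ≤ A.i) :
    Measurable fun ω => A.values η' f' ω k hk := by
  induction k with
  | zero => exact measurable_const
  | succ k ih =>
    have ih := ih (Nat.le_of_succ_le hk)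
    have hθ : Measurable fun ω => fun j => A.θ j ω := measurable_pi_iff.2 A.measurable_θ
    simp only [values_succ]
    have hu := measurable_snoc ih.fst (hf'.comp (measurable_const (a := A.t ⟨k, hk⟩).prodMk
      ((A.measurable_ψ ⟨k, hk⟩).comp
        (hθ.prodMk ((measurable_const (a := η')).prodMk (ih.fst.prodMk ih.snd))))))
    exact hu.prodMk (measurable_snoc ih.snd (hf'.comp ((A.measurable_θ ⟨k, hk⟩).prodMk
      ((A.measurable_χ ⟨k, hk⟩).comp
        (hθ.prodMk ((measurable_const (a := η')).prodMk (hu.prodMk ih.snd)))))))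

theorem measurable_output (A : Algorithm a b d Ω) (η' : E d) {f' : RHS a b d}
    (hf' : Measurable f') (s : Icc a b) : Measurable fun ω => A.output η' f' ω s := by
  have h := A.measurable_values η' hf' A.i le_rfl
  have hθ : Measurable fun ω => fun j => A.θ j ω := measurable_pi_iff.2 A.measurable_θ
  exact (A.measurable_φ s).comp
    (hθ.prodMk ((measurable_const (a := η')).prodMk (h.fst.prodMk h.snd)))

/-- The evaluation times do not adapt to the data, so right-hand sides that agree at these times,
for all `x`, cannot be told apart, however the spatial points are chosen. -/
theorem values_congr (A : Algorithm a b d Ω) (η' : E d) {f₁ f₂ : RHS a b d} {ω : Ω}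
    (ht : ∀ j x, f₁ (A.t j, x) = f₂ (A.t j, x)) (hθ : ∀ j x, f₁ (A.θ j ω, x) = f₂ (A.θ j ω, x))
    (k : ℕ) (hk : k ≤ A.i) : A.values η' f₁ ω k hk = A.values η' f₂ ω k hk := by
  induction k with
  | zero => rfl
  | succ k ih => rw [values_succ, values_succ, ih (Nat.le_of_succ_le hk), ht, hθ]

theorem output_congr (A : Algorithm a b d Ω) (η' : E d) {f₁ f₂ : RHS a b d} {ω : Ω}
    (ht : ∀ j x, f₁ (A.t j, x) = f₂ (A.t j, x))
    (hθ : ∀ j x, f₁ (A.θ j ω, x) = f₂ (A.θ j ω, x)) : A.output η' f₁ ω = A.output η' f₂ ω := by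
  rw [output, output, A.values_congr η' ht hθ]

end Algorithm

variable {P : Measure Ω}

/-- Reduces lower bounds to a scalar problem at one time. Monotonicity of `L^q` norms on a
probability space allows `q = 1` for the noise and `q = 2` for quadrature. -/
theorem eLpNorm'_coord_le_lpError [IsProbabilityMeasure P] {p q : ℝ} (hq : 0 < q) (hqp : q ≤ p)
    (M : Method a b d Ω) (η : E d) (f : RHS a b d) (η' : E d) (f' : RHS a b d) (t : Icc a b)
    (c : Fin d) (hM : Measurable fun ω => M η' f' ω t) :
    eLpNorm' (fun ω => sol η f t c - M η' f' ω t c) q P ≤ lpError P p M η f η' f' := by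
  have hm : Measurable fun ω => sol η f t c - M η' f' ω t c :=
    measurable_const.sub ((continuous_coord c).measurable.comp hM)
  refine (eLpNorm'_le_eLpNorm'_of_exponent_le hq hqp P hm.aestronglyMeasurable).trans ?_
  have hp : 0 < p := hq.trans_le hqp
  rw [eLpNorm', lpError]
  refine ENNReal.rpow_le_rpow (lintegral_mono fun ω => ENNReal.rpow_le_rpow ?_ hp.le)
    (one_div_nonneg.2 hp.le)
  refine le_trans ?_ (le_iSup (fun t : Icc a b => ‖sol η f t - M η' f' ω t‖ₑ) t)
  rw [← ofReal_norm, ← ofReal_norm]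
  exact ENNReal.ofReal_le_ofReal (abs_coord_le_norm (sol η f t - M η' f' ω t) c)

theorem lpError_le_worstError {K L ϱ p δ : ℝ} {M : Method a b d Ω} {η η' : E d}
    {f f' : RHS a b d} (hf : InClass a b d K L ϱ η f) (hn : IsNoisy δ η f η' f') :
    lpError P p M η f η' f' ≤ worstError P K L ϱ p δ M :=
  le_trans (le_iSup_of_le hn le_rfl) (le_iSup_of_le η (le_iSup_of_le f (le_iSup_of_le hf
    (le_iSup_of_le η' (le_iSup (fun f' => ⨆ (_ : IsNoisy δ η f η' f'), lpError P p M η f η' f')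
      f')))))

theorem IsNoisy.refl {δ : ℝ} (hδ : 0 ≤ δ) (η : E d) (f : RHS a b d) : IsNoisy δ η f η f :=
  ⟨Metric.mem_closedBall_self hδ, 0, measurable_const, fun _ => by simpa using hδ, by simp⟩

end AlgorithmBasic

/-! ### Lower bound from the noise -/

section NoiseLowerBound

variable {a b : ℝ} {d : ℕ} {K L ϱ : ℝ} {Ω : Type*} [MeasurableSpace Ω] {P : Measure Ω}
  [IsProbabilityMeasure P]

/-- The right-hand side `(t, x) ↦ g t • e_c`. -/
def timeRHS (a b : ℝ) (c : Fin d) (g : ℝ → ℝ) : RHS a b d :=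
  fun q => g q.1 • PiLp.single 1 c 1

theorem timeRHS_apply_coord (c : Fin d) (g : ℝ → ℝ) (q : Icc a b × E d) :
    timeRHS a b c g q c = g q.1 := by
  simp [timeRHS]

theorem inClass_timeRHS (hK : 0 ≤ K) (hL : 0 ≤ L) (c : Fin d) {η : E d} (hη : ‖η‖ ≤ K)
    {g : ℝ → ℝ} (hg : Continuous g) (hgK : ∀ t, |g t| ≤ K)
    (hgL : ∀ t s, |g t - g s| ≤ L * |t - s| ^ ϱ) : InClass a b d K L ϱ η (timeRHS a b c g) where
  norm_init := hη
  cont := by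
    have h : Continuous fun q : Icc a b × E d => g q.1 :=
      hg.comp (continuous_subtype_val.comp continuous_fst)
    exact h.smul continuous_const
  growth t x := by
    rw [timeRHS, norm_smul, PiLp.norm_single, norm_one, mul_one]
    exact (hgK _).trans (le_mul_of_one_le_right hK (by linarith [norm_nonneg x]))
  holder t s x _ := by
    rw [timeRHS, timeRHS, ← sub_smul, norm_smul, PiLp.norm_single, norm_one, mul_one]
    exact hgL _ _
  lipschitz t x _ y _ := by
    simp only [timeRHS, sub_self, norm_zero]
    positivity

theorem sol_timeRHS_coord (hab : a < b) (hK : 0 < K) (hL : 0 < L) (c : Fin d) {η : E d}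
    {g : ℝ → ℝ} (hf : InClass a b d K L ϱ η (timeRHS a b c g)) :
    sol η (timeRHS a b c g) b c = η c + ∫ x in a..b, g x := by
  have hz := isSolution_sol hab hK hL hf
  have h := hz.integral_slope_coord hab.le hf.cont c ⟨a, left_mem_Icc.2 hab.le⟩
    ⟨b, right_mem_Icc.2 hab.le⟩ hab.le
  simp only [hz.1, timeRHS_apply_coord] at h
  rw [← sub_eq_iff_eq_add', ← h]
  refine intervalIntegral.integral_congr fun x hx => ?_
  rw [uIcc_of_le hab.le] at hx
  simp only [projIcc_of_mem hab.le hx]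

theorem noise_le_worstError (hd : 0 < d) (hab : a < b) (hK : 0 < K) (hL : 0 < L) {p δ : ℝ}
    (hp : 1 ≤ p) (hδ0 : 0 ≤ δ) (hδK : δ ≤ K) (A : Algorithm a b d Ω) :
    ENNReal.ofReal δ ≤ worstError P K L ϱ p δ A.output := by
  set c : Fin d := ⟨0, hd⟩
  set t : Icc a b := ⟨b, right_mem_Icc.2 hab.le⟩ with ht
  set g : ℝ → ℝ := fun _ => 0 with hg
  set f := timeRHS a b c g with hf
  have hfm : Measurable f := (Measurable.smul_const (f := fun _ => (0 : ℝ)) measurable_const _)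
  have hcl : ∀ r : ℝ, |r| ≤ δ → InClass a b d K L ϱ (PiLp.single 1 c r) f := fun r hr =>
    inClass_timeRHS hK.le hL.le c (by rw [PiLp.norm_single]; exact hr.trans hδK) continuous_const
      (fun t => by simpa [hg] using hK.le) (fun t s => by
        simp only [hg, sub_self, abs_zero]
        positivity)
  have hno : ∀ r : ℝ, |r| ≤ δ → IsNoisy δ (PiLp.single 1 c r) f 0 f := fun r hr =>
    ⟨by rwa [mem_closedBall_iff_norm, zero_sub, norm_neg, PiLp.norm_single], 0, measurable_const,
      fun _ => by simpa using hδ0, by simp⟩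
  have hM := A.measurable_output 0 hfm t
  have hle : ∀ r : ℝ, |r| ≤ δ → ∫⁻ ω, ‖r - A.output 0 f ω t c‖ₑ ∂P ≤
      worstError P K L ϱ p δ A.output := by
    intro r hr
    have h := (eLpNorm'_coord_le_lpError (P := P) one_pos hp A.output (PiLp.single 1 c r) f 0 f t c
      hM).trans (lpError_le_worstError (hcl r hr) (hno r hr))
    have e : sol (PiLp.single 1 c r) f b c = r := by
      rw [sol_timeRHS_coord hab hK hL c (hcl r hr)]
      simp [hg]
    simpa only [eLpNorm', ht, e, ENNReal.rpow_one, one_div, inv_one] using h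
  have h1 := hle δ (abs_of_nonneg hδ0).le
  have h2 := hle (-δ) (by rw [abs_neg, abs_of_nonneg hδ0])
  have hm : ∀ r : ℝ, Measurable fun ω => ‖r - A.output 0 f ω t c‖ₑ := fun r =>
    (measurable_const.sub ((continuous_coord c).measurable.comp hM)).enorm
  have h3 : ENNReal.ofReal δ + ENNReal.ofReal δ ≤
      ∫⁻ ω, ‖δ - A.output 0 f ω t c‖ₑ ∂P + ∫⁻ ω, ‖-δ - A.output 0 f ω t c‖ₑ ∂P := by
    rw [← lintegral_add_left (hm δ)]
    have : ENNReal.ofReal δ + ENNReal.ofReal δ =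
        ∫⁻ _ : Ω, ENNReal.ofReal δ + ENNReal.ofReal δ ∂P := by simp
    rw [this]
    refine lintegral_mono fun ω => ?_
    rw [← ofReal_norm, ← ofReal_norm, ← ENNReal.ofReal_add hδ0 hδ0,
      ← ENNReal.ofReal_add (norm_nonneg _) (norm_nonneg _)]
    refine ENNReal.ofReal_le_ofReal ?_
    have := norm_sub_le (δ - A.output 0 f ω t c) (-δ - A.output 0 f ω t c)
    rw [sub_sub_sub_cancel_right, sub_neg_eq_add, Real.norm_eq_abs,
      abs_of_nonneg (by positivity)] at this
    exact this
  by_contra! hlt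
  exact absurd (h3.trans (add_le_add h1 h2)) (not_le.2 (ENNReal.add_lt_add hlt hlt))

end NoiseLowerBound

/-! ### Averaging over random signs -/

section Signs

variable {ι : Type*} [DecidableEq ι]

/-- The sign `±1` of a Boolean. -/
def boolSign (x : Bool) : ℝ := if x then 1 else -1

theorem boolSign_not (x : Bool) : boolSign (!x) = -boolSign x := by cases x <;> simp [boolSign]

theorem boolSign_mul_self (x : Bool) : boolSign x * boolSign x = 1 := by
  cases x <;> simp [boolSign]

theorem abs_boolSign (x : Bool) : |boolSign x| = 1 := by cases x <;> simp [boolSign]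

/-- Flip the value of a Boolean vector at one index. -/
def flipAt (k : ι) (ε : ι → Bool) : ι → Bool := Function.update ε k (!ε k)

theorem flipAt_same (k : ι) (ε : ι → Bool) : flipAt k ε k = !ε k := by simp [flipAt]

theorem flipAt_of_ne {j k : ι} (h : j ≠ k) (ε : ι → Bool) : flipAt k ε j = ε j := by
  simp [flipAt, h]

theorem flipAt_involutive (k : ι) : Function.Involutive (flipAt k) := fun ε => by
  simp [flipAt]

variable [Fintype ι]

theorem sum_eq_zero_of_flipAt {F : (ι → Bool) → ℝ} (k : ι) (hF : ∀ ε, F (flipAt k ε) = -F ε) :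
    ∑ ε, F ε = 0 := by
  have h := Equiv.sum_comp (flipAt_involutive k).toPerm F
  simp only [Function.Involutive.coe_toPerm, hF, Finset.sum_neg_distrib] at h
  linarith

/-- Orthogonality of signs: for `k ∉ S`, flipping `ε k` changes the sign of `boolSign (ε k)` and of
nothing else in the cross terms, `y` included, so these cancel and only the squares remain. -/
theorem sum_mul_signedSum_eq (I : ι → ℝ) (S : Finset ι) {y : (ι → Bool) → ℝ}
    (hy : ∀ k ∉ S, ∀ ε, y (flipAt k ε) = y ε) :
    ∑ ε, (∑ k, boolSign (ε k) * I k - y ε) * ∑ k ∈ Sᶜ, boolSign (ε k) * I k =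
      2 ^ Fintype.card ι * ∑ k ∈ Sᶜ, I k ^ 2 := by
  have h : ∀ k ∈ Sᶜ, ∑ ε, (∑ j, boolSign (ε j) * I j - y ε) * (boolSign (ε k) * I k) =
      2 ^ Fintype.card ι * I k ^ 2 := by
    intro k hk
    have h1 : ∀ ε : ι → Bool, (∑ j, boolSign (ε j) * I j - y ε) * (boolSign (ε k) * I k) =
        I k ^ 2 + (∑ j ∈ Finset.univ.erase k, boolSign (ε j) * I j - y ε) *
          (boolSign (ε k) * I k) := by
      intro ε
      rw [← Finset.add_sum_erase _ _ (Finset.mem_univ k)]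
      have := boolSign_mul_self (ε k)
      linear_combination I k ^ 2 * this
    rw [Finset.sum_congr rfl fun ε _ => h1 ε, Finset.sum_add_distrib,
      sum_eq_zero_of_flipAt k (F := fun ε => (∑ j ∈ Finset.univ.erase k, boolSign (ε j) * I j -
        y ε) * (boolSign (ε k) * I k))]
    · simp
    · intro ε
      simp only [hy k (Finset.mem_compl.1 hk), flipAt_same, boolSign_not]
      rw [Finset.sum_congr rfl fun j hj => by rw [flipAt_of_ne (Finset.ne_of_mem_erase hj)]]
      ring
  simp only [Finset.mul_sum]
  rw [Finset.sum_comm]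
  exact Finset.sum_congr rfl h

/-- Let `D` be the error and `Q` the part of the signed sum outside `S`. Summing `D ^ 2 ≥ 2 D Q - Q
^ 2` over all signs suffices, as `D Q` and `Q ^ 2` have the same total. -/
theorem le_sum_sq_signedSum_sub {I : ι → ℝ} {S : Finset ι} {y : (ι → Bool) → ℝ} {r : ℝ}
    (hr : 0 ≤ r) (hI : ∀ k, r ≤ I k) (hy : ∀ k ∉ S, ∀ ε, y (flipAt k ε) = y ε) {n : ℕ}
    (hn : n + S.card ≤ Fintype.card ι) :
    2 ^ Fintype.card ι * (n * r ^ 2) ≤ ∑ ε, (∑ k, boolSign (ε k) * I k - y ε) ^ 2 := by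
  have h1 := sum_mul_signedSum_eq I S hy
  -- The choice of `y` as the part of the sum over `S` makes the error equal to `Q`, giving the
  -- total of `Q ^ 2`.
  have h2 := sum_mul_signedSum_eq I S (y := fun ε => ∑ k ∈ S, boolSign (ε k) * I k)
    (fun k hk ε => Finset.sum_congr rfl fun j hj => by
      rw [flipAt_of_ne (ne_of_mem_of_not_mem hj hk)])
  have h3 : ∀ ε : ι → Bool, ∑ k, boolSign (ε k) * I k - ∑ k ∈ S, boolSign (ε k) * I k =
      ∑ k ∈ Sᶜ, boolSign (ε k) * I k := fun ε => by
    rw [← Finset.sum_add_sum_compl S]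
    ring
  simp only [h3] at h2
  have h4 : (n : ℝ) * r ^ 2 ≤ ∑ k ∈ Sᶜ, I k ^ 2 := by
    have h5 : Sᶜ.card • r ^ 2 ≤ ∑ k ∈ Sᶜ, I k ^ 2 :=
      Finset.card_nsmul_le_sum _ _ _ fun k _ => pow_le_pow_left₀ hr (hI k) 2
    have h6 : (n : ℝ) ≤ Sᶜ.card := by
      rw [Finset.card_compl]
      exact_mod_cast Nat.le_sub_of_add_le hn
    rw [nsmul_eq_mul] at h5
    exact (mul_le_mul_of_nonneg_right h6 (sq_nonneg r)).trans h5
  calc (2 : ℝ) ^ Fintype.card ι * (n * r ^ 2) ≤ 2 ^ Fintype.card ι * ∑ k ∈ Sᶜ, I k ^ 2 := by gcongr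
    _ = 2 * ∑ ε, (∑ k, boolSign (ε k) * I k - y ε) * ∑ k ∈ Sᶜ, boolSign (ε k) * I k -
        ∑ ε : ι → Bool, (∑ k ∈ Sᶜ, boolSign (ε k) * I k) * ∑ k ∈ Sᶜ, boolSign (ε k) * I k := by
      rw [h1, h2]; ring
    _ ≤ _ := by
      rw [Finset.mul_sum, ← Finset.sum_sub_distrib]
      refine Finset.sum_le_sum fun ε _ => ?_
      nlinarith [sq_nonneg ((∑ k, boolSign (ε k) * I k - y ε) -
        ∑ k ∈ Sᶜ, boolSign (ε k) * I k)]

end Signs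

end NoisyODE

end

noncomputable section

namespace NoisyODE

/-! ### Bump functions and their signed superpositions -/

section Bump

/-- The triangular bump with support `[a + k w, a + (k + 1) w]` and slopes `±1`. -/
def bump (a w : ℝ) (k : ℕ) (t : ℝ) : ℝ := max 0 (w / 2 - |t - (a + (k + 1 / 2) * w)|)

variable {a w : ℝ}

theorem continuous_bump (a w : ℝ) (k : ℕ) : Continuous (bump a w k) := by
  unfold bump
  fun_prop

theorem bump_nonneg (a w : ℝ) (k : ℕ) (t : ℝ) : 0 ≤ bump a w k t := le_max_left _ _

theorem bump_le (hw : 0 ≤ w) (k : ℕ) (t : ℝ) : bump a w k t ≤ w / 2 :=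
  max_le (by positivity) (by linarith [abs_nonneg (t - (a + (k + 1 / 2) * w))])

theorem abs_bump_sub_le (k : ℕ) (t s : ℝ) : |bump a w k t - bump a w k s| ≤ |t - s| := by
  refine (abs_max_sub_max_le_max _ _ _ _).trans ?_
  rw [sub_self, abs_zero, max_eq_right (abs_nonneg _), sub_sub_sub_cancel_left]
  refine (abs_abs_sub_abs_le _ _).trans (le_of_eq ?_)
  rw [sub_sub_sub_cancel_right, abs_sub_comm]

theorem eq_of_bump_ne_zero (hw : 0 < w) {j k : ℕ} {t : ℝ} (hj : bump a w j t ≠ 0)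
    (hk : bump a w k t ≠ 0) : j = k := by
  have h : ∀ i : ℕ, bump a w i t ≠ 0 → |t - (a + (i + 1 / 2) * w)| < w / 2 := fun i hi => by
    by_contra! hlt
    exact hi (max_eq_left (by linarith))
  have h1 := abs_lt.1 (h j hj)
  have h2 := abs_lt.1 (h k hk)
  have h3 : (j : ℝ) < k + 1 := by
    by_contra! h4
    nlinarith [mul_le_mul_of_nonneg_right h4 hw.le]
  have h4 : (k : ℝ) < j + 1 := by
    by_contra! h4
    nlinarith [mul_le_mul_of_nonneg_right h4 hw.le]
  have h5 : j < k + 1 := by exact_mod_cast h3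
  have h6 : k < j + 1 := by exact_mod_cast h4
  omega

theorem card_bump_ne_zero_le (hw : 0 < w) (N : ℕ) (t : ℝ) :
    (Finset.univ.filter fun k : Fin N => bump a w k t ≠ 0).card ≤ 1 := by
  refine Finset.card_le_one.2 fun j hj k hk => Fin.ext ?_
  exact eq_of_bump_ne_zero hw (Finset.mem_filter.1 hj).2 (Finset.mem_filter.1 hk).2

theorem sum_bump_le (hw : 0 < w) (N : ℕ) (t : ℝ) : ∑ k : Fin N, bump a w k t ≤ w / 2 := by
  rw [← Finset.sum_filter_ne_zero]
  refine (Finset.sum_le_card_nsmul _ (fun k : Fin N => bump a w k t) (w / 2)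
    fun k _ => bump_le hw.le k t).trans ?_
  have : ((Finset.univ.filter fun k : Fin N => bump a w k t ≠ 0).card : ℝ) ≤ 1 := by
    exact_mod_cast card_bump_ne_zero_le hw N t
  rw [nsmul_eq_mul]
  nlinarith

/-- At most one bump is nonzero at `t` and one at `s`. The resulting factor 2 is the reason for `L /
2` in `bumpHeight`. -/
theorem sum_abs_bump_sub_le (hw : 0 < w) (N : ℕ) (t s : ℝ) :
    ∑ k : Fin N, |bump a w k t - bump a w k s| ≤ 2 * min |t - s| w := by
  set S := (Finset.univ.filter fun k : Fin N => bump a w k t ≠ 0) ∪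
    (Finset.univ.filter fun k : Fin N => bump a w k s ≠ 0) with hS
  have h1 : ∑ k : Fin N, |bump a w k t - bump a w k s| =
      ∑ k ∈ S, |bump a w k t - bump a w k s| := by
    refine (Finset.sum_subset (Finset.subset_univ S) fun k _ hk => ?_).symm
    simp only [hS, Finset.mem_union, Finset.mem_filter, Finset.mem_univ, true_and, not_or,
      not_not] at hk
    rw [hk.1, hk.2, sub_zero, abs_zero]
  have h2 : S.card ≤ 2 := (Finset.card_union_le _ _).trans
    (add_le_add (card_bump_ne_zero_le hw N t) (card_bump_ne_zero_le hw N s))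
  have h3 : (S.card : ℝ) ≤ 2 := by exact_mod_cast h2
  rw [h1]
  refine (Finset.sum_le_card_nsmul _ _ (min |t - s| w) fun k _ => le_min (abs_bump_sub_le _ t s)
    ?_).trans ?_
  · rw [abs_le]
    constructor <;> linarith [bump_nonneg a w k t, bump_nonneg a w k s,
      bump_le (a := a) hw.le k t, bump_le (a := a) hw.le k s]
  · rw [nsmul_eq_mul]
    exact mul_le_mul_of_nonneg_right h3 (le_min (abs_nonneg _) hw.le)

/-- On the middle half of its support, of length `w / 2`, the bump is at least `w / 4`. -/
theorem le_integral_bump {b : ℝ} {N k : ℕ} (hab : a < b) (hk : k < N) (hw : w = (b - a) / N) :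
    w ^ 2 / 8 ≤ ∫ x in a..b, bump a w k x := by
  have hN : (0 : ℝ) < N := Nat.cast_pos.2 (by omega)
  have hw0 : 0 < w := hw ▸ div_pos (sub_pos.2 hab) hN
  have hNw : N * w = b - a := by rw [hw]; field_simp
  have hk1 : (k : ℝ) + 1 ≤ N := by exact_mod_cast hk
  have hkw : ((k : ℝ) + 1) * w ≤ b - a := hNw ▸ mul_le_mul_of_nonneg_right hk1 hw0.le
  have hkw0 : 0 ≤ (k : ℝ) * w := by positivity
  set c := a + ((k : ℝ) + 1 / 2) * w with hc
  have hi : ∀ u v : ℝ, IntervalIntegrable (bump a w k) volume u v := fun u v =>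
    (continuous_bump a w k).intervalIntegrable u v
  calc w ^ 2 / 8 = ∫ _ in (c - w / 4)..(c + w / 4), w / 4 := by
        rw [intervalIntegral.integral_const, smul_eq_mul]; ring
    _ ≤ ∫ x in (c - w / 4)..(c + w / 4), bump a w k x := by
        refine intervalIntegral.integral_mono_on (by linarith) (by simp) (hi _ _) fun x hx => ?_
        have : |x - c| ≤ w / 4 := abs_le.2 ⟨by linarith [hx.1], by linarith [hx.2]⟩
        exact le_max_of_le_right (by linarith)
    _ ≤ _ := intervalIntegral.integral_mono_interval (by linarith) (by linarith) (by linarith)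
        (ae_of_all _ fun x => bump_nonneg a w k x) (hi a b)

/-- The signed superposition of `N` bumps. -/
def bumpSum (a w κ : ℝ) {N : ℕ} (ε : Fin N → Bool) (t : ℝ) : ℝ :=
  ∑ k : Fin N, boolSign (ε k) * (κ * bump a w k t)

theorem continuous_bumpSum (a w κ : ℝ) {N : ℕ} (ε : Fin N → Bool) :
    Continuous (bumpSum a w κ ε) :=
  continuous_finsetSum _ fun k _ =>
    continuous_const.mul (continuous_const.mul (continuous_bump a w k))

theorem abs_bumpSum_le {κ : ℝ} (hκ : 0 ≤ κ) (hw : 0 < w) {N : ℕ} (ε : Fin N → Bool) (t : ℝ) :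
    |bumpSum a w κ ε t| ≤ κ * (w / 2) := by
  refine (Finset.abs_sum_le_sum_abs _ _).trans ?_
  refine le_trans (le_of_eq ?_) (mul_le_mul_of_nonneg_left (sum_bump_le (a := a) hw N t) hκ)
  rw [Finset.mul_sum]
  refine Finset.sum_congr rfl fun k _ => ?_
  rw [abs_mul, abs_boolSign, one_mul, abs_of_nonneg (mul_nonneg hκ (bump_nonneg _ _ _ _))]

theorem abs_bumpSum_sub_le {κ : ℝ} (hκ : 0 ≤ κ) (hw : 0 < w) {N : ℕ} (ε : Fin N → Bool)
    (t s : ℝ) : |bumpSum a w κ ε t - bumpSum a w κ ε s| ≤ κ * (2 * min |t - s| w) := by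
  rw [bumpSum, bumpSum, ← Finset.sum_sub_distrib]
  refine (Finset.abs_sum_le_sum_abs _ _).trans ?_
  refine le_trans (le_of_eq ?_) (mul_le_mul_of_nonneg_left (sum_abs_bump_sub_le (a := a) hw N t s) hκ)
  rw [Finset.mul_sum]
  refine Finset.sum_congr rfl fun k _ => ?_
  rw [← mul_sub, ← mul_sub, abs_mul, abs_boolSign, one_mul, abs_mul, abs_of_nonneg hκ]

theorem min_le_rpow_mul_rpow {x w ϱ : ℝ} (hx : 0 ≤ x) (hw : 0 < w) (hϱ0 : 0 ≤ ϱ) (hϱ1 : ϱ ≤ 1) :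
    min x w ≤ x ^ ϱ * w ^ (1 - ϱ) := by
  rcases hx.eq_or_lt with rfl | hx
  · exact (min_le_left _ _).trans (by positivity)
  have h0 : 0 < min x w := lt_min hx hw
  calc min x w = min x w ^ ϱ * min x w ^ (1 - ϱ) := by rw [← Real.rpow_add h0]; simp
    _ ≤ _ := mul_le_mul (Real.rpow_le_rpow h0.le (min_le_left _ _) hϱ0)
      (Real.rpow_le_rpow h0.le (min_le_right _ _) (sub_nonneg.2 hϱ1)) (by positivity) (by positivity)

theorem integral_bumpSum (a b w κ : ℝ) {N : ℕ} (ε : Fin N → Bool) :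
    ∫ x in a..b, bumpSum a w κ ε x =
      ∑ k : Fin N, boolSign (ε k) * (κ * ∫ x in a..b, bump a w k x) := by
  unfold bumpSum
  have hi : ∀ k : Fin N, IntervalIntegrable (fun x => boolSign (ε k) * (κ * bump a w k x))
      volume a b := fun k =>
    (continuous_const.mul (continuous_const.mul (continuous_bump a w k))).intervalIntegrable _ _
  rw [intervalIntegral.integral_finsetSum fun k _ => hi k]
  simp only [intervalIntegral.integral_const_mul]

theorem bumpSum_flipAt {κ : ℝ} {N : ℕ} {k : Fin N} (ε : Fin N → Bool) {t : ℝ}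
    (hk : bump a w k t = 0) : bumpSum a w κ (flipAt k ε) t = bumpSum a w κ ε t := by
  refine Finset.sum_congr rfl fun j _ => ?_
  by_cases hj : j = k
  · subst hj
    rw [hk]
    simp
  · rw [flipAt_of_ne hj]

end Bump

/-! ### Lower bound from quadrature, and conclusion -/

section QuadratureLowerBound

variable {a b : ℝ} {d : ℕ} {K L ϱ : ℝ} {Ω : Type*} [MeasurableSpace Ω] {P : Measure Ω}
  [IsProbabilityMeasure P]

/-- The Hölder height of the bumps in the lower bound. -/
def bumpHeight (a b K L ϱ : ℝ) : ℝ := min (L / 2) (K / (b - a) ^ ϱ)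

theorem bumpHeight_pos (hab : a < b) (hK : 0 < K) (hL : 0 < L) : 0 < bumpHeight a b K L ϱ :=
  lt_min (by positivity) (div_pos hK (Real.rpow_pos_of_pos (sub_pos.2 hab) _))

/-- The scaling `w ^ (ϱ - 1)` makes the Hölder constant `2 * bumpHeight`, at most `L`, independent
of `w`, while the supremum is at most `bumpHeight * w ^ ϱ / 2`, hence at most `K`. -/
theorem inClass_bumpSum (hab : a < b) (hK : 0 < K) (hL : 0 < L) (hϱ0 : 0 < ϱ) (hϱ1 : ϱ ≤ 1)
    (c : Fin d) (hw : 0 < w) (hwl : w ≤ b - a) {N : ℕ} (ε : Fin N → Bool) :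
    InClass a b d K L ϱ 0
      (timeRHS a b c (bumpSum a w (bumpHeight a b K L ϱ * w ^ (ϱ - 1)) ε)) := by
  have hH := bumpHeight_pos (ϱ := ϱ) hab hK hL
  set H := bumpHeight a b K L ϱ with hHdef
  have hl : 0 < b - a := sub_pos.2 hab
  have hκ : 0 ≤ H * w ^ (ϱ - 1) := by positivity
  refine inClass_timeRHS hK.le hL.le c (by simpa using hK.le) (continuous_bumpSum _ _ _ ε)
    (fun t => (abs_bumpSum_le hκ hw ε t).trans ?_)
    (fun t s => (abs_bumpSum_sub_le hκ hw ε t s).trans ?_)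
  · have h1 : H * w ^ (ϱ - 1) * (w / 2) = H * w ^ ϱ / 2 := by
      rw [Real.rpow_sub_one hw.ne']
      field_simp
    have h2 : H * w ^ ϱ ≤ K / (b - a) ^ ϱ * (b - a) ^ ϱ :=
      mul_le_mul (min_le_right _ _) (Real.rpow_le_rpow hw.le hwl hϱ0.le) (by positivity)
        (by positivity)
    rw [div_mul_cancel₀ _ (Real.rpow_pos_of_pos hl _).ne'] at h2
    rw [h1]
    linarith
  · calc H * w ^ (ϱ - 1) * (2 * min |t - s| w)
        ≤ H * w ^ (ϱ - 1) * (2 * (|t - s| ^ ϱ * w ^ (1 - ϱ))) := by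
          gcongr
          exact min_le_rpow_mul_rpow (abs_nonneg _) hw hϱ0.le hϱ1
      _ = 2 * H * |t - s| ^ ϱ * (w ^ (ϱ - 1) * w ^ (1 - ϱ)) := by ring
      _ = 2 * H * |t - s| ^ ϱ := by
          rw [← Real.rpow_add hw]
          simp
      _ ≤ L * |t - s| ^ ϱ := by
          gcongr
          have : H ≤ L / 2 := min_le_left _ _
          linarith

theorem sqrt_mul_le_worstError (hd : 0 < d) (hab : a < b) (hK : 0 < K) (hL : 0 < L)
    (hϱ0 : 0 < ϱ) (hϱ1 : ϱ ≤ 1) {p δ : ℝ} (hp : 2 ≤ p) (hδ0 : 0 ≤ δ) {n : ℕ} (hn : 0 < n)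
    (A : Algorithm a b d Ω) (hA : 2 * A.i ≤ n) {w : ℝ} (hw : w = (b - a) / (2 * n : ℕ)) :
    ENNReal.ofReal (√n * (bumpHeight a b K L ϱ * w ^ (ϱ - 1) * (w ^ 2 / 8))) ≤
      worstError P K L ϱ p δ A.output := by
  have hl : 0 < b - a := sub_pos.2 hab
  have hN : (1 : ℝ) ≤ (2 * n : ℕ) := by exact_mod_cast (by omega : 1 ≤ 2 * n)
  have hw0 : 0 < w := hw ▸ div_pos hl (by linarith)
  have hwl : w ≤ b - a := hw ▸ div_le_self hl.le hN
  have hH := bumpHeight_pos (ϱ := ϱ) hab hK hL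
  set κ := bumpHeight a b K L ϱ * w ^ (ϱ - 1) with hκ
  have hκ0 : 0 < κ := by positivity
  set r := κ * (w ^ 2 / 8) with hr
  have hr0 : 0 ≤ r := by positivity
  set c : Fin d := ⟨0, hd⟩
  set t : Icc a b := ⟨b, right_mem_Icc.2 hab.le⟩ with ht
  set f : (Fin (2 * n) → Bool) → RHS a b d := fun ε => timeRHS a b c (bumpSum a w κ ε) with hf
  have hcl : ∀ ε, InClass a b d K L ϱ 0 (f ε) := fun ε =>
    inClass_bumpSum hab hK hL hϱ0 hϱ1 c hw0 hwl ε
  set I : Fin (2 * n) → ℝ := fun k => κ * ∫ x in a..b, bump a w k x with hI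
  have hIr : ∀ k, r ≤ I k := fun k =>
    mul_le_mul_of_nonneg_left (le_integral_bump hab k.2 hw) hκ0.le
  set y : Ω → (Fin (2 * n) → Bool) → ℝ := fun ω ε => A.output 0 (f ε) ω t c with hy
  have hsol : ∀ ε, sol 0 (f ε) b c = ∑ k, boolSign (ε k) * I k := fun ε => by
    rw [hf, sol_timeRHS_coord hab hK hL c (hcl ε), integral_bumpSum]
    simp [hI]
  set W := worstError P K L ϱ p δ A.output with hW
  have hM : ∀ ε, Measurable fun ω => A.output 0 (f ε) ω t := fun ε =>
    A.measurable_output 0 (hcl ε).cont.measurable t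
  have hle : ∀ ε, ∫⁻ ω, ‖∑ k, boolSign (ε k) * I k - y ω ε‖ₑ ^ (2 : ℝ) ∂P ≤ W ^ (2 : ℝ) := by
    intro ε
    have h := (eLpNorm'_coord_le_lpError (P := P) two_pos hp A.output 0 (f ε) 0 (f ε) t c
      (hM ε)).trans (lpError_le_worstError (hcl ε) (IsNoisy.refl hδ0 0 (f ε)))
    have h2 := ENNReal.rpow_le_rpow h (by norm_num : (0 : ℝ) ≤ 2)
    rw [eLpNorm', ← ENNReal.rpow_mul] at h2
    simpa only [ht, hsol, one_div, inv_mul_cancel₀ (two_ne_zero' ℝ), ENNReal.rpow_one] using h2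
  have hpt : ∀ ω, ENNReal.ofReal (2 ^ (2 * n) * (n * r ^ 2)) ≤
      ∑ ε, ‖∑ k, boolSign (ε k) * I k - y ω ε‖ₑ ^ (2 : ℝ) := by
    intro ω
    -- The bumps met at some evaluation time. For fixed `ω` this set does not depend on the signs,
    -- and as each time meets at most one bump it has at most `2 * A.i ≤ n` elements.
    set S : Finset (Fin (2 * n)) :=
      (Finset.univ.biUnion fun j => Finset.univ.filter fun k : Fin (2 * n) =>
        bump a w k (A.t j) ≠ 0) ∪
      (Finset.univ.biUnion fun j => Finset.univ.filter fun k : Fin (2 * n) =>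
        bump a w k (A.θ j ω) ≠ 0) with hS
    have hcard : S.card ≤ n := by
      have h1 : ∀ u : Fin A.i → ℝ, (Finset.univ.biUnion fun j =>
          Finset.univ.filter fun k : Fin (2 * n) => bump a w k (u j) ≠ 0).card ≤ A.i := fun u =>
        (Finset.card_biUnion_le_card_mul _ _ 1 fun j _ =>
          card_bump_ne_zero_le hw0 _ _).trans (by simp)
      exact (Finset.card_union_le _ _).trans
        ((add_le_add (h1 fun j => A.t j) (h1 fun j => A.θ j ω)).trans (by omega))
    have hinv : ∀ k ∉ S, ∀ ε, y ω (flipAt k ε) = y ω ε := by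
      intro k hk ε
      simp only [hS, Finset.mem_union, Finset.mem_biUnion, Finset.mem_filter, Finset.mem_univ,
        true_and, not_or, not_exists, not_not] at hk
      simp only [hy, hf]
      rw [A.output_congr 0 (f₁ := timeRHS a b c (bumpSum a w κ (flipAt k ε)))
        (f₂ := timeRHS a b c (bumpSum a w κ ε))]
      · intro j x
        simp only [timeRHS, bumpSum_flipAt ε (hk.1 j)]
      · intro j x
        simp only [timeRHS, bumpSum_flipAt ε (hk.2 j)]
    have h := le_sum_sq_signedSum_sub hr0 hIr hinv (n := n) (by rw [Fintype.card_fin]; omega)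
    rw [Fintype.card_fin] at h
    refine (ENNReal.ofReal_le_ofReal h).trans (le_of_eq ?_)
    rw [ENNReal.ofReal_sum_of_nonneg fun _ _ => sq_nonneg _]
    refine Finset.sum_congr rfl fun ε _ => ?_
    rw [← ofReal_norm, ENNReal.ofReal_rpow_of_nonneg (norm_nonneg _) (by norm_num),
      Real.rpow_two, Real.norm_eq_abs, sq_abs]
  -- Averaging over signs inside the expectation: the worst case dominates the mean over all `2 ^ (2
  -- * n)` problems, whose total squared error is bounded below for every `ω`.
  have hsum : ENNReal.ofReal (2 ^ (2 * n) * (n * r ^ 2)) ≤ 2 ^ (2 * n) * W ^ (2 : ℝ) := by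
    calc ENNReal.ofReal (2 ^ (2 * n) * (n * r ^ 2))
        = ∫⁻ _ : Ω, ENNReal.ofReal (2 ^ (2 * n) * (n * r ^ 2)) ∂P := by simp
      _ ≤ ∫⁻ ω, ∑ ε, ‖∑ k, boolSign (ε k) * I k - y ω ε‖ₑ ^ (2 : ℝ) ∂P := lintegral_mono hpt
      _ = ∑ ε, ∫⁻ ω, ‖∑ k, boolSign (ε k) * I k - y ω ε‖ₑ ^ (2 : ℝ) ∂P :=
          lintegral_finsetSum _ fun ε _ => ((measurable_const.sub
            ((continuous_coord c).measurable.comp (hM ε))).enorm.pow_const _)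
      _ ≤ ∑ _ε : Fin (2 * n) → Bool, W ^ (2 : ℝ) := Finset.sum_le_sum fun ε _ => hle ε
      _ = 2 ^ (2 * n) * W ^ (2 : ℝ) := by simp
  rw [ENNReal.ofReal_mul (by positivity), ENNReal.ofReal_pow (by norm_num), ENNReal.ofReal_ofNat]
    at hsum
  have hsq := (ENNReal.mul_le_mul_iff_right (pow_ne_zero _ two_ne_zero)
    (ENNReal.pow_ne_top ENNReal.ofNat_ne_top)).1 hsum
  have e : (n : ℝ) * r ^ 2 = (√n * r) ^ (2 : ℝ) := by
    rw [Real.rpow_two, mul_pow (√(n : ℝ)), Real.sq_sqrt (Nat.cast_nonneg n)]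
  rw [e, ← ENNReal.ofReal_rpow_of_nonneg (by positivity) (by norm_num)] at hsq
  exact (ENNReal.rpow_le_rpow_iff two_pos).1 hsq

/-- The constant in the lower bound for the minimal errors. -/
def lowerConst (a b K L ϱ : ℝ) : ℝ :=
  min 1 (bumpHeight a b K L ϱ * ((b - a) / 2) ^ (1 + ϱ) / 8)

theorem lowerConst_pos (hab : a < b) (hK : 0 < K) (hL : 0 < L) : 0 < lowerConst a b K L ϱ := by
  have := bumpHeight_pos (ϱ := ϱ) hab hK hL
  have := sub_pos.2 hab
  exact lt_min one_pos (by positivity)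

theorem le_minError (hd : 0 < d) (hab : a < b) (hK : 0 < K) (hL : 0 < L)
    (hϱ0 : 0 < ϱ) (hϱ1 : ϱ ≤ 1) {p δ : ℝ} (hp : 2 ≤ p) (hδ0 : 0 ≤ δ) (hδK : δ ≤ K) {n : ℕ}
    (hn : 0 < n) :
    ENNReal.ofReal (lowerConst a b K L ϱ * max ((n : ℝ) ^ (-(ϱ + 1 / 2))) δ) ≤
      minError a b d P K L ϱ p n δ := by
  refine le_iInf₂ fun M hM => ?_
  obtain ⟨A, hA, rfl⟩ := hM
  have hl : 0 < b - a := sub_pos.2 hab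
  have hn0 : (0 : ℝ) < n := Nat.cast_pos.2 hn
  have hc := lowerConst_pos (ϱ := ϱ) hab hK hL
  rw [mul_max_of_nonneg _ _ hc.le, ENNReal.ofReal_max]
  refine max_le ?_ ?_
  · refine le_trans (ENNReal.ofReal_le_ofReal ?_)
      (sqrt_mul_le_worstError hd hab hK hL hϱ0 hϱ1 hp hδ0 hn A hA rfl)
    have hw : (0 : ℝ) < (b - a) / (2 * n : ℕ) := div_pos hl (Nat.cast_pos.2 (by omega))
    have e1 : ∀ w : ℝ, 0 < w → w ^ (ϱ - 1) * w ^ 2 = w ^ (1 + ϱ) := fun w hw => by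
      rw [← Real.rpow_two, ← Real.rpow_add hw]
      congr 1
      ring
    have e2 : ((b - a) / (2 * n : ℕ)) ^ (1 + ϱ) =
        ((b - a) / 2) ^ (1 + ϱ) * (n : ℝ) ^ (-(1 + ϱ)) := by
      rw [Real.rpow_neg hn0.le, ← div_eq_mul_inv, ← Real.div_rpow (by positivity) hn0.le]
      push_cast
      rw [div_div]
    have e3 : √(n : ℝ) * (n : ℝ) ^ (-(1 + ϱ)) = (n : ℝ) ^ (-(ϱ + 1 / 2)) := by
      rw [Real.sqrt_eq_rpow, ← Real.rpow_add hn0]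
      congr 1
      ring
    calc lowerConst a b K L ϱ * (n : ℝ) ^ (-(ϱ + 1 / 2))
        ≤ bumpHeight a b K L ϱ * ((b - a) / 2) ^ (1 + ϱ) / 8 * (n : ℝ) ^ (-(ϱ + 1 / 2)) :=
          mul_le_mul_of_nonneg_right (min_le_right _ _) (by positivity)
      _ = √n * (bumpHeight a b K L ϱ * (((b - a) / 2) ^ (1 + ϱ) * (n : ℝ) ^ (-(1 + ϱ))) / 8) := by
          rw [← e3]; ring
      _ = _ := by
          rw [← e2, ← e1 _ hw]; ring
  · refine le_trans (ENNReal.ofReal_le_ofReal ?_)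
      (noise_le_worstError hd hab hK hL (by linarith) hδ0 hδK A)
    exact mul_le_of_le_one_left hδ0 (min_le_left _ _)

end QuadratureLowerBound

end NoisyODE

end

theorem theorem3p2 (d : ℕ) (hd : 0 < d) (a b : ℝ) (hab : a < b) (K L : ℝ) (hK : 0 < K)
    (hL : 0 < L) (ϱ : ℝ) (hϱ0 : 0 < ϱ) (hϱ1 : ϱ ≤ 1) (p : ℝ) (hp : 2 ≤ p) :
    ∃ (c C δ₀ : ℝ) (n₀ : ℕ), 0 < c ∧ 0 < C ∧ 0 < δ₀ ∧ δ₀ ≤ 1 ∧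
      ∀ (Ω : Type*) [MeasurableSpace Ω] (P : Measure Ω) [IsProbabilityMeasure P],
        (∀ n : ℕ, n₀ ≤ n → ∀ δ ∈ Icc 0 δ₀,
          ENNReal.ofReal (c * max ((n : ℝ) ^ (-(ϱ + 1 / 2))) δ)
            ≤ NoisyODE.minError a b d P K L ϱ p n δ) ∧
        ∀ τ : ℕ → Ω → unitInterval, (∀ j, Measurable (τ j)) → iIndepFun τ P →
          (∀ j, P.map (τ j) = volume) →
          ∀ n : ℕ, n₀ ≤ n →
            NoisyODE.rungeKutta hab.le (n / 2) τ ∈ NoisyODE.Phi a b d Ω n ∧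
            ∀ δ ∈ Icc 0 δ₀,
              NoisyODE.minError a b d P K L ϱ p n δ
                ≤ ENNReal.ofReal (C * max ((n : ℝ) ^ (-(ϱ + 1 / 2))) δ) ∧
              NoisyODE.worstError P K L ϱ p δ
                  (NoisyODE.rungeKutta (d := d) hab.le (n / 2) τ)
                ≤ ENNReal.ofReal (C * max ((n : ℝ) ^ (-(ϱ + 1 / 2))) δ) := by
  -- `n₀ = 2` guarantees at least one step. For `δ₀ = min 1 K`, the bound 1 keeps the noisy scheme
  -- in the ball and `K` keeps the initial values `±δ e_c` in the class.
  refine ⟨NoisyODE.lowerConst a b K L ϱ, NoisyODE.upperConst a b d K L ϱ p, min 1 K, 2,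
    NoisyODE.lowerConst_pos hab hK hL, NoisyODE.upperConst_pos hab hK hL p, lt_min one_pos hK,
    min_le_left _ _, fun Ω _ P _ => ⟨fun n hn δ hδ => ?_, fun τ hτ hind hunif n hn => ?_⟩⟩
  · exact NoisyODE.le_minError hd hab hK hL hϱ0 hϱ1 hp hδ.1 (hδ.2.trans (min_le_right _ _))
      (by omega)
  · have hmem := NoisyODE.rungeKutta_mem_Phi (d := d) hab hτ hn
    refine ⟨hmem, fun δ hδ => ?_⟩
    have h := NoisyODE.worstError_rungeKutta_le (P := P) hd hab hK hL hϱ0 hϱ1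
      (by linarith : 0 < p) hδ.1 (hδ.2.trans (min_le_left _ _)) hτ hind hunif hn
    exact ⟨(iInf₂_le _ hmem).trans h, h⟩
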